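/- Let $d\in\mathbb N$ and let $(M_p)_{p\in\mathbb N}$, $(A_p)_{p\in\mathbb N}$ be sequences of positive numbers with $M_0=M_1=A_0=A_1=1$. Assume that both satisfy - $(M.1)$: $N_p^2\le N_{p-1}N_{p+1}$ for $p\ge 1$, and - $(M.2)$: there are $c_0,H\ge 1$ with $N_p\le c_0H^p\min_{0\le q\le p}N_{p-q}N_q$ for $p\in\mathbb N$; that $(M_p)$ satisfies - $(M.5)$: there are $q>0$ and $c_0\ge1$ with $\sum_{j=p+1}^\infty M_{j-1}^q/M_j^q\le c_0\,p\,M_p^q/M_{p+1}^q$ for all $p\ge 1$; and that $(A_p)$ satisfies - $(M.6)$: there are $c_0,L_0\ge1$ with $p!\le c_0L_0^pA_p$ for $p\in\mathbb N$. Let $A(\rho)=\sup_{p\in\mathbb N}\log_+(\rho^p/A_p)$ be the associated function of $(A_p)$. Let $\mathfrak R$ be the set of positive sequences $(t_p)_{p\ge1}$ increasing to $\infty$, and for $(t_p)\in\mathfrak R$ let $B_{t_p}$ be the associated function of the sequence $A_p\prod_{j=1}^pt_j$. For $h>0$ let $\mathcal S^{M_p,h}_{A_p,h}$ be the Banach space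 of all $\varphi\in C^\infty(\mathbb R^d)$ with $$\sigma_h(\varphi)=\sup_{\alpha\in\mathbb N^d}\frac{h^{|\alpha|}\,\|e^{A(h|\cdot|)}D^\alpha\varphi\|_{L^\infty(\mathbb R^d)}}{M_{|\alpha|}}<\infty .$$ Let $\mathcal S^{(M_p)}_{(A_p)}=\varprojlim_{h\to\infty}\mathcal S^{M_p,h}_{A_p,h}$ and $\mathcal S^{\{M_p\}}_{\{A_p\}}=\varinjlim_{h\to0}\mathcal S^{M_p,h}_{A_p,h}$ as locally convex spaces, with topological duals $\mathcal S'^{(M_p)}_{(A_p)}$ and $\mathcal S'^{\{M_p\}}_{\{A_p\}}$. Write $\mathcal S^{(M_p)}_{(p!)}$, $\mathcal S^{\{M_p\}}_{\{p!\}}$ for these spaces when $A_p$ is replaced by $p!$; since $p!\subset A_p$ they are contained in $\mathcal S^{(M_p)}_{(A_p)}$, $\mathcal S^{\{M_p\}}_{\{A_p\}}$, respectively. A functional on the smaller space is said to belong to the dual of the larger one if it is the restriction of a continuous linear functional on the larger one. For $f$ in the dual and $\varphi$ in the corresponding test space put $(f*\varphi)(x)=\langle f,\varphi(x-\cdot)\rangle$,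 $x\in\mathbb R^d$. Let $f\in\mathcal S'^{(M_p)}_{(p!)}$ (resp. $f\in\mathcal S'^{\{M_p\}}_{\{p!\}}$). Then $f\in\mathcal S'^{(M_p)}_{(A_p)}$ (resp. $f\in\mathcal S'^{\{M_p\}}_{\{A_p\}}$) if and only if there exists $t>0$ (resp. $(t_p)\in\mathfrak R$) such that for every $\varphi\in\mathcal S^{(M_p)}_{(p!)}$ (resp. $\varphi\in\mathcal S^{\{M_p\}}_{\{p!\}}$) $$\sup_{x\in\mathbb R^d}e^{-A(t|x|)}|(f*\varphi)(x)|<\infty\qquad\Big(\text{resp. }\sup_{x\in\mathbb R^d}e^{-B_{t_p}(|x|)}|(f*\varphi)(x)|<\infty\Big).$$ -/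

import Mathlib

open scoped ContDiff

/-! ### Weight sequences -/

/-- The sequence `N` is positive, `N 0 = N 1 = 1`, and it satisfies `(M.1)` (logarithmic convexity)
and `(M.2)` (stability under ultradifferential operators). -/
structure IsWeightSequence (N : ℕ → ℝ) : Prop where
  pos : ∀ p, 0 < N p
  zero : N 0 = 1
  one : N 1 = 1
  logConvex : ∀ p, 1 ≤ p → N p ^ 2 ≤ N (p - 1) * N (p + 1)
  stable : ∃ c H : ℝ, 1 ≤ c ∧ 1 ≤ H ∧ ∀ p q, q ≤ p → N p ≤ c * H ^ p * (N (p - q) * N q)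

/-- Weight sequences `M` measuring regularity: they satisfy `(M.1)`, `(M.2)` and `(M.5)`, the last
one saying that `M ^ q` is strongly non-quasianalytic for some `q > 0`, i.e.
`∑_{j ≥ p + 1} M_{j-1}^q / M_j^q ≤ c p M_p^q / M_{p+1}^q` for all `p ≥ 1`
(in the sum below `j = p + 1 + i`). -/
structure RegularityWeight where
  toFun : ℕ → ℝ
  isWeight : IsWeightSequence toFun
  strong : ∃ q : ℝ, 0 < q ∧ ∃ c : ℝ, 1 ≤ c ∧ ∀ p : ℕ, 1 ≤ p →
    Summable (fun i : ℕ => toFun (p + i) ^ q / toFun (p + 1 + i) ^ q) ∧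
    ∑' i : ℕ, toFun (p + i) ^ q / toFun (p + 1 + i) ^ q
      ≤ c * p * (toFun p ^ q / toFun (p + 1) ^ q)

/-- Weight sequences `A` measuring decay: they satisfy `(M.1)`, `(M.2)` and `(M.6)`, the last one
saying `p! ⊂ A_p`. -/
structure DecayWeight where
  toFun : ℕ → ℝ
  isWeight : IsWeightSequence toFun
  factorial_le : ∃ c L : ℝ, 1 ≤ c ∧ 1 ≤ L ∧ ∀ p : ℕ, (p.factorial : ℝ) ≤ c * L ^ p * toFun p

instance : CoeFun RegularityWeight (fun _ => ℕ → ℝ) := ⟨RegularityWeight.toFun⟩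

instance : CoeFun DecayWeight (fun _ => ℕ → ℝ) := ⟨DecayWeight.toFun⟩

/-- The sequence `p!` as a decay weight. -/
def factorialWeight : DecayWeight where
  toFun p := (p.factorial : ℝ)
  isWeight :=
    { pos := fun p => by positivity
      zero := by simp
      one := by simp
      logConvex := by
        intro p hp
        obtain ⟨n, rfl⟩ : ∃ n, p = n + 1 := ⟨p - 1, by omega⟩
        have h : (0 : ℝ) < (n.factorial : ℝ) := by positivity
        simp only [Nat.add_sub_cancel, Nat.factorial_succ]
        push_cast
        have hn : (0 : ℝ) ≤ n := by positivity
        nlinarith [mul_nonneg (mul_pos h h).le (by positivity : (0 : ℝ) ≤ (n : ℝ) + 1)]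
      stable := by
        refine ⟨1, 2, le_refl _, by norm_num, fun p q hq => ?_⟩
        have h1 := Nat.choose_mul_factorial_mul_factorial hq
        have h2 : p.choose q ≤ 2 ^ p := Nat.choose_le_two_pow p q
        have h3 : p.factorial ≤ 2 ^ p * ((p - q).factorial * q.factorial) := by
          rw [← h1, mul_assoc, mul_comm (p - q).factorial]
          exact Nat.mul_le_mul_right _ h2
        rw [one_mul]
        exact_mod_cast h3 }
  factorial_le := ⟨1, 1, le_refl _, le_refl _, fun p => by simp⟩

/-- The family `ℜ` of positive sequences `(t_p)_{p ≥ 1}` increasing to `∞`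
(the value at the index `0` is never used). -/
structure IsIncreasingToInfinity (t : ℕ → ℝ) : Prop where
  pos : ∀ p, 0 < t p
  monotone : Monotone t
  tendsto : Filter.Tendsto t Filter.atTop Filter.atTop

/-- The associated function `ρ ↦ sup_p log₊ (ρ ^ p / N_p)` of a sequence `N` with `N 0 = 1`. -/
noncomputable def associatedFunction (N : ℕ → ℝ) (ρ : ℝ) : ℝ :=
  ⨆ p : ℕ, Real.posLog (ρ ^ p / N p)

/-- The sequence `A_p ∏_{j=1}^p t_j`. -/
noncomputable def twistedWeight (A : DecayWeight) (t : ℕ → ℝ) (p : ℕ) : ℝ :=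
  A p * ∏ j ∈ Finset.Icc 1 p, t j

namespace DecayWeight

theorem bddAbove (A : DecayWeight) {ρ : ℝ} (hρ : 0 ≤ ρ) :
    BddAbove (Set.range fun p : ℕ => Real.posLog (ρ ^ p / A p)) := by
  obtain ⟨c, L, hc, hL, h⟩ := A.factorial_le
  refine ⟨Real.posLog (c * Real.exp (L * ρ)), ?_⟩
  rintro _ ⟨p, rfl⟩
  have hA := A.isWeight.pos p
  refine Real.posLog_le_posLog (by positivity) ?_
  have h1 : (L * ρ) ^ p / p.factorial ≤ Real.exp (L * ρ) :=
    Real.pow_div_factorial_le_exp _ (by positivity) _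
  have hf : (0 : ℝ) < p.factorial := by positivity
  rw [div_le_iff₀ hf, mul_pow] at h1
  rw [div_le_iff₀ hA]
  have hLp : 0 < L ^ p := by positivity
  have h2 : L ^ p * ρ ^ p ≤ L ^ p * (c * Real.exp (L * ρ) * A p) :=
    calc L ^ p * ρ ^ p ≤ Real.exp (L * ρ) * p.factorial := h1
      _ ≤ Real.exp (L * ρ) * (c * L ^ p * A p) := by
          gcongr
          exact h p
      _ = _ := by ring
  exact le_of_mul_le_mul_left h2 hLp

theorem associatedFunction_mono (A : DecayWeight) {ρ ρ' : ℝ} (h0 : 0 ≤ ρ) (h : ρ ≤ ρ') :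
    associatedFunction A ρ ≤ associatedFunction A ρ' := by
  refine ciSup_mono (A.bddAbove (h0.trans h)) fun p => ?_
  have hA := A.isWeight.pos p
  exact Real.posLog_le_posLog (by positivity) (by gcongr)

theorem associatedFunction_nonneg (A : DecayWeight) (ρ : ℝ) : 0 ≤ associatedFunction A ρ :=
  Real.iSup_nonneg fun _ => Real.posLog_nonneg

theorem associatedFunction_add_le (A : DecayWeight) {a b c : ℝ} (ha : 0 ≤ a) (h : a ≤ b + c) :
    associatedFunction A a ≤ associatedFunction A (2 * b) + associatedFunction A (2 * c) := by
  have hb' := A.associatedFunction_nonneg (2 * b)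
  have hc' := A.associatedFunction_nonneg (2 * c)
  rcases le_total b c with hbc | hbc
  · have := A.associatedFunction_mono ha (show a ≤ 2 * c by linarith)
    linarith
  · have := A.associatedFunction_mono ha (show a ≤ 2 * b by linarith)
    linarith

/-- `p! ⊂ A_p` gives `A(ρ) ≤ log₊ c + F(L ρ)`, with `F` the associated function of `p!`. -/
theorem exists_associatedFunction_le (A : DecayWeight) : ∃ K L : ℝ, 1 ≤ L ∧ ∀ ρ, 0 ≤ ρ →
    associatedFunction A ρ ≤ K + associatedFunction factorialWeight (L * ρ) := by
  obtain ⟨c, L, hc, hL, h⟩ := A.factorial_le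
  refine ⟨Real.posLog c, L, hL, fun ρ hρ => ciSup_le fun p => ?_⟩
  have hA := A.isWeight.pos p
  have hf : (0 : ℝ) < p.factorial := by positivity
  calc Real.posLog (ρ ^ p / A p) ≤ Real.posLog (c * ((L * ρ) ^ p / p.factorial)) := by
        refine Real.posLog_le_posLog (by positivity) ?_
        rw [div_le_iff₀ hA, mul_pow, mul_div_assoc', div_mul_eq_mul_div, le_div_iff₀ hf]
        calc ρ ^ p * p.factorial ≤ ρ ^ p * (c * L ^ p * A p) := by
              gcongr
              exact h p
          _ = _ := by ring
    _ ≤ Real.posLog c + Real.posLog ((L * ρ) ^ p / p.factorial) := Real.posLog_mul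
    _ ≤ _ := by
        gcongr
        exact le_ciSup (factorialWeight.bddAbove (show 0 ≤ L * ρ by positivity)) p

end DecayWeight

/-! ### Partial derivatives -/

section GelfandShilov

variable {d : ℕ}

/-- The partial derivative `∂_j φ`. -/
noncomputable def partialD (j : Fin d) (φ : EuclideanSpace ℝ (Fin d) → ℂ) :
    EuclideanSpace ℝ (Fin d) → ℂ :=
  fun x => fderiv ℝ φ x (EuclideanSpace.single j 1)

/-- The iterated partial derivative `∂^α φ = ∂_1^{α_1} ⋯ ∂_d^{α_d} φ`
(note `|D^α φ| = |∂^α φ|` for `D = -i ∂`). -/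
noncomputable def iteratedPartial (α : Fin d → ℕ) (φ : EuclideanSpace ℝ (Fin d) → ℂ) :
    EuclideanSpace ℝ (Fin d) → ℂ :=
  (List.finRange d).foldr (fun j g => (partialD j)^[α j] g) φ

theorem iteratedPartial_induction {ι : Type*}
    {P : (ι → EuclideanSpace ℝ (Fin d) → ℂ) → Prop}
    (hP : ∀ j F, P F → P (fun i => partialD j (F i))) (α : Fin d → ℕ)
    {F : ι → EuclideanSpace ℝ (Fin d) → ℂ} (hF : P F) :
    P (fun i => iteratedPartial α (F i)) := by
  unfold iteratedPartial
  induction List.finRange d with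
  | nil => exact hF
  | cons j l ih =>
    simp only [List.foldr_cons]
    induction α j with
    | zero => exact ih
    | succ n ihn =>
      simp only [Function.iterate_succ_apply']
      exact hP j _ ihn

theorem ContDiff.partialD {φ : EuclideanSpace ℝ (Fin d) → ℂ} (h : ContDiff ℝ ∞ φ) (j : Fin d) :
    ContDiff ℝ ∞ (partialD j φ) :=
  (h.fderiv_right (m := ∞) (by simp)).clm_apply contDiff_const

theorem iteratedPartial_add {φ ψ : EuclideanSpace ℝ (Fin d) → ℂ} (hφ : ContDiff ℝ ∞ φ)
    (hψ : ContDiff ℝ ∞ ψ) (α : Fin d → ℕ) :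
    iteratedPartial α (φ + ψ) = iteratedPartial α φ + iteratedPartial α ψ := by
  have := iteratedPartial_induction (ι := Fin 3)
    (P := fun F => ContDiff ℝ ∞ (F 0) ∧ ContDiff ℝ ∞ (F 1) ∧ F 2 = F 0 + F 1)
    (F := ![φ, ψ, φ + ψ]) ?_ α ⟨hφ, hψ, rfl⟩
  · exact this.2.2
  · rintro j F ⟨h0, h1, h2⟩
    refine ⟨h0.partialD j, h1.partialD j, ?_⟩
    ext x
    simp only [h2, partialD, Pi.add_apply]
    rw [fderiv_add (h0.differentiable (by simp) x) (h1.differentiable (by simp) x)]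
    rfl

theorem iteratedPartial_smul {φ : EuclideanSpace ℝ (Fin d) → ℂ} (hφ : ContDiff ℝ ∞ φ)
    (c : ℂ) (α : Fin d → ℕ) : iteratedPartial α (c • φ) = c • iteratedPartial α φ := by
  have := iteratedPartial_induction (ι := Fin 2)
    (P := fun F => ContDiff ℝ ∞ (F 0) ∧ F 1 = c • F 0)
    (F := ![φ, c • φ]) ?_ α ⟨hφ, rfl⟩
  · exact this.2
  · rintro j F ⟨h0, h2⟩
    refine ⟨h0.partialD j, ?_⟩
    ext x
    simp only [h2, partialD, Pi.smul_apply]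
    rw [fderiv_const_smul (h0.differentiable (by simp) x)]
    rfl

theorem norm_iteratedPartial_reflect (φ : EuclideanSpace ℝ (Fin d) → ℂ)
    (α : Fin d → ℕ) (x y : EuclideanSpace ℝ (Fin d)) :
    ‖iteratedPartial α (fun z => φ (x - z)) y‖ = ‖iteratedPartial α φ (x - y)‖ := by
  have key : ∀ (j : Fin d) (g : EuclideanSpace ℝ (Fin d) → ℂ) (z : EuclideanSpace ℝ (Fin d)),
      partialD j (fun z => g (x - z)) z = -partialD j g (x - z) := by
    intro j g z
    have h1 : (fun z => g (x - z)) = (fun w => g (x + w)) ∘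
        (ContinuousLinearEquiv.neg ℝ (M := EuclideanSpace ℝ (Fin d))) := by
      ext w
      simp [sub_eq_add_neg]
    simp only [partialD]
    rw [h1, ContinuousLinearEquiv.comp_right_fderiv, fderiv_comp_add_left]
    simp [sub_eq_add_neg]
  have := iteratedPartial_induction (ι := Fin 2)
    (P := fun F => (F 1 = fun z => F 0 (x - z)) ∨ F 1 = -fun z => F 0 (x - z))
    (F := ![φ, fun z => φ (x - z)]) ?_ α (Or.inl rfl)
  · rcases this with h | h
    · exact congrArg norm (congrFun h y)
    · exact (congrArg norm (congrFun h y)).trans (norm_neg _)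
  · rintro j F (h | h)
    · right
      ext z
      simp only [h, key, Pi.neg_apply]
    · left
      ext z
      have : partialD j (F 1) z = -partialD j (fun z => F 0 (x - z)) z := by
        simp only [h, partialD]
        rw [fderiv_neg]
        rfl
      simp only [this, key, neg_neg]

/-! ### The Banach spaces of step `h` -/

/-- `h^{|α|} e^{A(h|x|)} |D^α φ(x)| / M_{|α|}`. -/
noncomputable def gsTerm (M : RegularityWeight) (A : DecayWeight) (h : ℝ)
    (φ : EuclideanSpace ℝ (Fin d) → ℂ) (i : (Fin d → ℕ) × EuclideanSpace ℝ (Fin d)) : ℝ :=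
  h ^ (∑ j, i.1 j) * (Real.exp (associatedFunction A (h * ‖i.2‖)) * ‖iteratedPartial i.1 φ i.2‖)
    / M (∑ j, i.1 j)

theorem gsTerm_nonneg (M : RegularityWeight) (A : DecayWeight) {h : ℝ} (hh : 0 < h)
    (φ : EuclideanSpace ℝ (Fin d) → ℂ) (i) : 0 ≤ gsTerm M A h φ i := by
  have := M.isWeight.pos (∑ j, i.1 j)
  unfold gsTerm
  positivity

theorem gsTerm_add_le (M : RegularityWeight) (A : DecayWeight) {h : ℝ} (hh : 0 < h)
    {φ ψ : EuclideanSpace ℝ (Fin d) → ℂ} (hφ : ContDiff ℝ ∞ φ) (hψ : ContDiff ℝ ∞ ψ) (i) :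
    gsTerm M A h (φ + ψ) i ≤ gsTerm M A h φ i + gsTerm M A h ψ i := by
  have := M.isWeight.pos (∑ j, i.1 j)
  unfold gsTerm
  rw [iteratedPartial_add hφ hψ, ← add_div, ← mul_add, ← mul_add]
  gcongr
  exact norm_add_le _ _

theorem gsTerm_smul (M : RegularityWeight) (A : DecayWeight) (h : ℝ)
    {φ : EuclideanSpace ℝ (Fin d) → ℂ} (hφ : ContDiff ℝ ∞ φ) (c : ℂ) (i) :
    gsTerm M A h (c • φ) i = ‖c‖ * gsTerm M A h φ i := by
  unfold gsTerm
  rw [iteratedPartial_smul hφ, Pi.smul_apply, norm_smul]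
  ring

theorem gsTerm_zero (M : RegularityWeight) (A : DecayWeight) (h : ℝ)
    (i : (Fin d → ℕ) × EuclideanSpace ℝ (Fin d)) : gsTerm M A h 0 i = 0 := by
  have := gsTerm_smul M A h (d := d) (φ := 0) contDiff_const 0 i
  simpa using this

/-- The smooth functions `φ` with `sup_{α, x} h^{|α|} e^{A(h|x|)} |D^α φ(x)| / M_{|α|} < ∞`. -/
def gsStepSubmodule (d : ℕ) (M : RegularityWeight) (A : DecayWeight) (h : {h : ℝ // 0 < h}) :
    Submodule ℂ (EuclideanSpace ℝ (Fin d) → ℂ) where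
  carrier := {φ | ContDiff ℝ ∞ φ ∧ BddAbove (Set.range (gsTerm M A h φ))}
  zero_mem' := ⟨contDiff_const, 0, by
    rintro _ ⟨i, rfl⟩
    exact (gsTerm_zero M A h i).le⟩
  add_mem' := by
    rintro φ ψ ⟨hφ, C, hC⟩ ⟨hψ, C', hC'⟩
    refine ⟨hφ.add hψ, C + C', ?_⟩
    rintro _ ⟨i, rfl⟩
    exact (gsTerm_add_le M A h.2 hφ hψ i).trans (add_le_add (hC ⟨i, rfl⟩) (hC' ⟨i, rfl⟩))
  smul_mem' := by
    rintro c φ ⟨hφ, C, hC⟩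
    refine ⟨contDiff_const.smul hφ, ‖c‖ * C, ?_⟩
    rintro _ ⟨i, rfl⟩
    rw [gsTerm_smul M A h hφ]
    exact mul_le_mul_of_nonneg_left (hC ⟨i, rfl⟩) (norm_nonneg c)

/-- The Banach space `S^{M_p,h}_{A_p,h}`. -/
def GSStep (d : ℕ) (M : RegularityWeight) (A : DecayWeight) (h : {h : ℝ // 0 < h}) : Type :=
  gsStepSubmodule d M A h

section Step

variable (M : RegularityWeight) (A : DecayWeight) (h : {h : ℝ // 0 < h})

noncomputable instance : AddCommGroup (GSStep d M A h) :=
  inferInstanceAs (AddCommGroup (gsStepSubmodule d M A h))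

noncomputable instance : Module ℂ (GSStep d M A h) :=
  inferInstanceAs (Module ℂ (gsStepSubmodule d M A h))

/-- The norm `σ_h`. -/
noncomputable instance : Norm (GSStep d M A h) := ⟨fun φ => ⨆ i, gsTerm M A h φ.1 i⟩

theorem GSStep.normCore : NormedSpace.Core ℂ (GSStep d M A h) where
  norm_nonneg φ := Real.iSup_nonneg (gsTerm_nonneg M A h.2 φ.1)
  norm_smul c φ := by
    change ⨆ i, gsTerm M A h (c • φ.1) i = ‖c‖ * ⨆ i, gsTerm M A h φ.1 i
    rw [Real.mul_iSup_of_nonneg (norm_nonneg c)]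
    simp only [gsTerm_smul M A h φ.2.1]
  norm_triangle φ ψ := by
    refine ciSup_le fun i => ?_
    exact (gsTerm_add_le M A h.2 φ.2.1 ψ.2.1 i).trans
      (add_le_add (le_ciSup φ.2.2 i) (le_ciSup ψ.2.2 i))
  norm_eq_zero_iff φ := by
    constructor
    · intro h0
      refine Subtype.ext (funext fun x => ?_)
      have h1 : gsTerm M A h φ.1 (0, x) ≤ 0 := (le_ciSup φ.2.2 (0, x)).trans h0.le
      have h2 : iteratedPartial (0 : Fin d → ℕ) φ.1 = φ.1 := by
        unfold iteratedPartial
        induction List.finRange d with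
        | nil => rfl
        | cons j l ih => simp
      simp only [gsTerm, h2, Pi.zero_apply, Finset.sum_const_zero, pow_zero, one_mul,
        M.isWeight.zero, div_one] at h1
      have h3 := Real.exp_pos (associatedFunction A (h * ‖x‖))
      have h4 : ‖φ.1 x‖ ≤ 0 := by
        by_contra hcon
        exact absurd (mul_pos h3 (not_le.1 hcon)) (not_lt.2 h1)
      exact norm_le_zero_iff.1 h4
    · rintro rfl
      change ⨆ i, gsTerm M A h 0 i = 0
      simp only [gsTerm_zero, Real.iSup_const_zero]

noncomputable instance : NormedAddCommGroup (GSStep d M A h) :=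
  NormedAddCommGroup.ofCore (GSStep.normCore M A h)

noncomputable instance : NormedSpace ℂ (GSStep d M A h) :=
  NormedSpace.ofCore (GSStep.normCore M A h)

end Step

/-- The steps decrease as `h` grows. -/
theorem gsStepSubmodule_anti (M : RegularityWeight) (A : DecayWeight) {h h' : {h : ℝ // 0 < h}}
    (hh : h ≤ h') : gsStepSubmodule d M A h' ≤ gsStepSubmodule d M A h := by
  rintro φ ⟨hφ, C, hC⟩
  refine ⟨hφ, C, ?_⟩
  rintro _ ⟨i, rfl⟩
  refine le_trans ?_ (hC ⟨i, rfl⟩)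
  have hM := M.isWeight.pos (∑ j, i.1 j)
  have h0 : (0 : ℝ) < h := h.2
  have h0' : (0 : ℝ) < h' := h'.2
  have hle : (h : ℝ) ≤ h' := hh
  have := A.associatedFunction_mono (ρ := h * ‖i.2‖) (ρ' := h' * ‖i.2‖) (by positivity)
    (by gcongr)
  unfold gsTerm
  gcongr

/-- Since `p! ⊂ A_p`, steps for the weight `p!` are contained in steps for the weight `A_p`. -/
theorem exists_gsStepSubmodule_factorial_le (A : DecayWeight) : ∃ L : {h : ℝ // 0 < h},
    ∀ (d : ℕ) (M : RegularityWeight) (h h' : {h : ℝ // 0 < h}), (h' : ℝ) = L * h →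
      gsStepSubmodule d M factorialWeight h' ≤ gsStepSubmodule d M A h := by
  obtain ⟨K, L, hL, hK⟩ := A.exists_associatedFunction_le
  refine ⟨⟨L, by linarith⟩, fun d M h h' hh => ?_⟩
  rintro φ ⟨hφ, C, hC⟩
  refine ⟨hφ, Real.exp K * C, ?_⟩
  rintro _ ⟨i, rfl⟩
  refine le_trans ?_ (mul_le_mul_of_nonneg_left (hC ⟨i, rfl⟩) (Real.exp_pos K).le)
  have hM := M.isWeight.pos (∑ j, i.1 j)
  have h0 : (0 : ℝ) < h := h.2
  have h0' : (0 : ℝ) < h' := h'.2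
  have hle : (h : ℝ) ≤ h' := by
    rw [hh]
    exact le_mul_of_one_le_left h0.le hL
  have h1 := hK (h * ‖i.2‖) (by positivity)
  have h2 : Real.exp (associatedFunction A (h * ‖i.2‖))
      ≤ Real.exp K * Real.exp (associatedFunction factorialWeight (h' * ‖i.2‖)) := by
    rw [← Real.exp_add, hh, mul_assoc]
    exact Real.exp_le_exp.2 h1
  unfold gsTerm
  calc _ ≤ (h' : ℝ) ^ (∑ j, i.1 j) * ((Real.exp K *
        Real.exp (associatedFunction factorialWeight (h' * ‖i.2‖))) * ‖iteratedPartial i.1 φ i.2‖)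
          / M (∑ j, i.1 j) := by gcongr
    _ = _ := by ring

/-- Steps are mapped into steps by `φ ↦ φ(x - ·)`. -/
theorem reflect_mem_gsStepSubmodule (M : RegularityWeight) (A : DecayWeight)
    {h h' : {h : ℝ // 0 < h}} (hh : (h' : ℝ) = 2 * h) {φ : EuclideanSpace ℝ (Fin d) → ℂ}
    (hφ : φ ∈ gsStepSubmodule d M A h') (x : EuclideanSpace ℝ (Fin d)) :
    (fun y => φ (x - y)) ∈ gsStepSubmodule d M A h := by
  obtain ⟨hφ, C, hC⟩ := hφ
  refine ⟨hφ.comp (contDiff_const.sub contDiff_id),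
    Real.exp (associatedFunction A (h' * ‖x‖)) * C, ?_⟩
  rintro _ ⟨⟨α, y⟩, rfl⟩
  refine le_trans ?_ (mul_le_mul_of_nonneg_left (hC ⟨(α, x - y), rfl⟩) (Real.exp_pos _).le)
  have hM := M.isWeight.pos (∑ j, α j)
  have h0 : (0 : ℝ) < h := h.2
  have h0' : (0 : ℝ) < h' := h'.2
  have hle : (h : ℝ) ≤ h' := by
    rw [hh]
    linarith
  have h1 := A.associatedFunction_add_le (a := h * ‖y‖) (b := h * ‖x‖) (c := h * ‖x - y‖)
    (by positivity) (by
      rw [← mul_add]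
      gcongr
      calc ‖y‖ = ‖x - (x - y)‖ := by simp
        _ ≤ _ := norm_sub_le _ _)
  rw [← mul_assoc, ← mul_assoc, ← hh] at h1
  have h2 : Real.exp (associatedFunction A (h * ‖y‖)) ≤
      Real.exp (associatedFunction A (h' * ‖x‖)) *
        Real.exp (associatedFunction A (h' * ‖x - y‖)) := by
    rw [← Real.exp_add]
    exact Real.exp_le_exp.2 h1
  unfold gsTerm
  simp only [norm_iteratedPartial_reflect]
  calc _ ≤ (h' : ℝ) ^ (∑ j, α j) * ((Real.exp (associatedFunction A (h' * ‖x‖)) *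
        Real.exp (associatedFunction A (h' * ‖x - y‖))) * ‖iteratedPartial α φ (x - y)‖)
          / M (∑ j, α j) := by gcongr
    _ = _ := by ring

/-! ### The Beurling space -/

/-- The test space `S^{(M_p)}_{(A_p)}(ℝ^d)`: the projective limit of the steps as `h → ∞`. -/
def GSBeurling (d : ℕ) (M : RegularityWeight) (A : DecayWeight) : Type :=
  (⨅ h, gsStepSubmodule d M A h : Submodule ℂ (EuclideanSpace ℝ (Fin d) → ℂ))

namespace GSBeurling

variable {M : RegularityWeight} {A : DecayWeight}

noncomputable instance : AddCommGroup (GSBeurling d M A) := inferInstanceAs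
  (AddCommGroup (⨅ h, gsStepSubmodule d M A h : Submodule ℂ (EuclideanSpace ℝ (Fin d) → ℂ)))

noncomputable instance : Module ℂ (GSBeurling d M A) := inferInstanceAs
  (Module ℂ (⨅ h, gsStepSubmodule d M A h : Submodule ℂ (EuclideanSpace ℝ (Fin d) → ℂ)))

/-- The canonical inclusion into the step `h`. -/
noncomputable def toStep (h : {h : ℝ // 0 < h}) : GSBeurling d M A →ₗ[ℂ] GSStep d M A h :=
  Submodule.inclusion (iInf_le _ h)

/-- The projective limit topology. -/
noncomputable instance : TopologicalSpace (GSBeurling d M A) :=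
  ⨅ h : {h : ℝ // 0 < h}, TopologicalSpace.induced (toStep h) inferInstance

/-- The continuous linear functionals on the test space: the space `S'^{(M_p)}_{(A_p)}(ℝ^d)`. -/
abbrev Dual (d : ℕ) (M : RegularityWeight) (A : DecayWeight) : Type := GSBeurling d M A →L[ℂ] ℂ

/-- The test function `y ↦ φ(x - y)`. -/
noncomputable def reflect (φ : GSBeurling d M A) (x : EuclideanSpace ℝ (Fin d)) : GSBeurling d M A :=
  ⟨fun y => φ.1 (x - y), (Submodule.mem_iInf _).2 fun h =>
    reflect_mem_gsStepSubmodule M A (h' := ⟨2 * h, mul_pos two_pos h.2⟩) rfl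
      ((Submodule.mem_iInf _).1 φ.2 _) x⟩

/-- The convolution `(f * φ)(x) = ⟨f, φ(x - ·)⟩`. -/
noncomputable def conv (f : Dual d M A) (φ : GSBeurling d M A) (x : EuclideanSpace ℝ (Fin d)) : ℂ :=
  f (reflect φ x)

/-- The inclusion `S^{(M_p)}_{(p!)} ⊆ S^{(M_p)}_{(A_p)}`. -/
noncomputable def ofFactorial (M : RegularityWeight) (A : DecayWeight) :
    GSBeurling d M factorialWeight →ₗ[ℂ] GSBeurling d M A :=
  Submodule.inclusion (le_iInf fun h => by
    obtain ⟨L, hL⟩ := exists_gsStepSubmodule_factorial_le A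
    exact (iInf_le _ (⟨L * h, mul_pos L.2 h.2⟩ : {h : ℝ // 0 < h})).trans (hL d M h _ rfl))

end GSBeurling

/-- `f ∈ S'^{(M_p)}_{(p!)}` belongs to `S'^{(M_p)}_{(A_p)}`: it is the restriction of a continuous
linear functional on `S^{(M_p)}_{(A_p)}`. -/
def GSBeurling.BelongsToDual (A : DecayWeight) {M : RegularityWeight}
    (f : GSBeurling.Dual d M factorialWeight) : Prop :=
  ∃ g : GSBeurling.Dual d M A, ∀ φ, g (GSBeurling.ofFactorial M A φ) = f φ

/-! ### The Roumieu space -/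

/-- The test space `S^{{M_p}}_{{A_p}}(ℝ^d)`: the inductive limit of the steps as `h → 0`. -/
def GSRoumieu (d : ℕ) (M : RegularityWeight) (A : DecayWeight) : Type :=
  (⨆ h, gsStepSubmodule d M A h : Submodule ℂ (EuclideanSpace ℝ (Fin d) → ℂ))

/-- The underlying set of the Roumieu space is the union of the steps. -/
theorem mem_iSup_gsStepSubmodule {M : RegularityWeight} {A : DecayWeight}
    {φ : EuclideanSpace ℝ (Fin d) → ℂ} :
    φ ∈ (⨆ h, gsStepSubmodule d M A h) ↔ ∃ h, φ ∈ gsStepSubmodule d M A h := by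
  have : Nonempty {h : ℝ // 0 < h} := ⟨⟨1, one_pos⟩⟩
  exact Submodule.mem_iSup_of_directed _ fun a b =>
    ⟨min a b, gsStepSubmodule_anti M A (min_le_left a b),
      gsStepSubmodule_anti M A (min_le_right a b)⟩

namespace GSRoumieu

variable {M : RegularityWeight} {A : DecayWeight}

noncomputable instance : AddCommGroup (GSRoumieu d M A) := inferInstanceAs
  (AddCommGroup (⨆ h, gsStepSubmodule d M A h : Submodule ℂ (EuclideanSpace ℝ (Fin d) → ℂ)))

noncomputable instance : Module ℂ (GSRoumieu d M A) := inferInstanceAs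
  (Module ℂ (⨆ h, gsStepSubmodule d M A h : Submodule ℂ (EuclideanSpace ℝ (Fin d) → ℂ)))

/-- The canonical inclusion of the step `h`. -/
noncomputable def ofStep (h : {h : ℝ // 0 < h}) : GSStep d M A h →ₗ[ℂ] GSRoumieu d M A :=
  Submodule.inclusion (le_iSup (gsStepSubmodule d M A) h)

/-- The inductive limit topology in the category of locally convex spaces: the finest locally
convex vector space topology making the inclusions of all steps continuous. -/
noncomputable instance : TopologicalSpace (GSRoumieu d M A) :=
  sInf {τ | @IsTopologicalAddGroup _ τ _ ∧ @ContinuousSMul ℂ _ _ _ τ ∧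
    @LocallyConvexSpace ℝ _ _ _ _ (Module.complexToReal _) τ ∧
    ∀ h : {h : ℝ // 0 < h}, @Continuous _ _ inferInstance τ (ofStep (d := d) (M := M) (A := A) h)}

/-- The continuous linear functionals on the test space: the space `S'^{{M_p}}_{{A_p}}(ℝ^d)`. -/
abbrev Dual (d : ℕ) (M : RegularityWeight) (A : DecayWeight) : Type := GSRoumieu d M A →L[ℂ] ℂ

/-- The test function `y ↦ φ(x - y)`. -/
noncomputable def reflect (φ : GSRoumieu d M A) (x : EuclideanSpace ℝ (Fin d)) : GSRoumieu d M A :=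
  ⟨fun y => φ.1 (x - y), by
    obtain ⟨h, hφ⟩ := mem_iSup_gsStepSubmodule.1 φ.2
    exact mem_iSup_gsStepSubmodule.2 ⟨⟨h / 2, half_pos h.2⟩,
      reflect_mem_gsStepSubmodule M A (by ring) hφ x⟩⟩

/-- The convolution `(f * φ)(x) = ⟨f, φ(x - ·)⟩`. -/
noncomputable def conv (f : Dual d M A) (φ : GSRoumieu d M A) (x : EuclideanSpace ℝ (Fin d)) : ℂ :=
  f (reflect φ x)

/-- The inclusion `S^{{M_p}}_{{p!}} ⊆ S^{{M_p}}_{{A_p}}`. -/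
noncomputable def ofFactorial (M : RegularityWeight) (A : DecayWeight) :
    GSRoumieu d M factorialWeight →ₗ[ℂ] GSRoumieu d M A :=
  Submodule.inclusion (iSup_le fun h => by
    obtain ⟨L, hL⟩ := exists_gsStepSubmodule_factorial_le A
    exact (hL d M ⟨h / L, div_pos h.2 L.2⟩ h (mul_div_cancel₀ _ (ne_of_gt L.2)).symm).trans
      (le_iSup (gsStepSubmodule d M A) _))

end GSRoumieu

/-- `f ∈ S'^{{M_p}}_{{p!}}` belongs to `S'^{{M_p}}_{{A_p}}`: it is the restriction of a continuous
linear functional on `S^{{M_p}}_{{A_p}}`. -/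
def GSRoumieu.BelongsToDual (A : DecayWeight) {M : RegularityWeight}
    (f : GSRoumieu.Dual d M factorialWeight) : Prop :=
  ∃ g : GSRoumieu.Dual d M A, ∀ φ, g (GSRoumieu.ofFactorial M A φ) = f φ

end GelfandShilov

/-! Suppose first that `f` is the restriction of `g`. Continuity of `g` bounds `(f * φ)(x) = g(φ(x -
·))` by a step norm of `φ(x - ·)`, and this is at most `exp (A (2h|x|)) σ_{2h}(φ)`. In the Beurling
case that is the claim. In the Roumieu case such a bound holds for all small `h`, with constants
`K_n` at the scale `1/n` depending on `g` alone. `exists_twistedWeight_of_forall_le` dominates the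
whole family by one twisted weight.

For the converse, weighted bounds on each `f * φ` become uniform in `φ` by the uniform boundedness
principle: the Beurling space is a Baire space, and the Roumieu steps are Banach spaces. Take `θ`
with `∑_n θ(n - ·) = 1` over the integer lattice, with derivatives controlled by `ε^|α| M_|α|` for
every `ε` and with decay faster than any exponential. Then `ψ = ∑_n ψ θ(n - ·)`, and each summand is
the reflection at `n` of `localize θ n ψ`, which lies in the small space even if `ψ` is only in the
large one. This suggests the extension `g(ψ) = ∑_n (f * localize θ n ψ)(n)`. By
`IsLocalizer.exists_gsTerm_localize_le` the localization at `n` has norm `O(exp (-A (k|n|/2)))`.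
Against the growth of `f * φ` this leaves a quotient `exp (A (t|n|)) / exp (A (Ht|n|))`, which (M.2)
makes summable, so `g` is defined and continuous. For `φ` in the small space the decomposition
converges in that space (`IsLocalizer.hasSum_localize`), so `g` extends `f`.

The function `θ` comes from the Fourier transform `χ` of `exp (-ξ^{2m})`. Condition (M.5) provides
`m` with `L^n n! ≤ c M_n^{2m}` for every `L`, hence the derivative bounds. Shifting the contour
gives exponential decay of every rate. Since `∫ χ = 1`, the integrals of `χ` over unit intervals
form a partition of unity on the line, and tensor products give the one on `ℝ^d`. -/

/-! ### Weight sequences and associated functions -/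

namespace IsWeightSequence

variable {N : ℕ → ℝ}

theorem ratio_monotone (hN : IsWeightSequence N) : Monotone fun p => N (p + 1) / N p := by
  refine monotone_nat_of_le_succ fun p => ?_
  have h0 := hN.pos p
  have h1 := hN.pos (p + 1)
  have h := hN.logConvex (p + 1) (by omega)
  rw [Nat.add_sub_cancel] at h
  rw [div_le_div_iff₀ h0 h1]
  nlinarith

theorem monotone (hN : IsWeightSequence N) : Monotone N := by
  refine monotone_nat_of_le_succ fun p => ?_
  have h := hN.ratio_monotone (Nat.zero_le p)
  simp only [zero_add, hN.zero, hN.one, div_one] at h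
  rwa [le_div_iff₀ (hN.pos p), one_mul] at h

theorem one_le (hN : IsWeightSequence N) (p : ℕ) : 1 ≤ N p := by
  have h := hN.monotone (Nat.zero_le p)
  rwa [hN.zero] at h

/-- Increasing ratios and `N 0 = 1`: each of the `q` ratios that build `N q` is at most the ratio
`p` places further on. -/
theorem mul_le_add (hN : IsWeightSequence N) (p q : ℕ) : N p * N q ≤ N (p + q) := by
  induction q with
  | zero => simp [hN.zero]
  | succ q ih =>
    have h := hN.ratio_monotone (Nat.le_add_left q p)
    have h0 := hN.pos q
    have h1 := hN.pos (p + q)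
    have h2 := hN.pos (q + 1)
    simp only at h
    rw [div_le_div_iff₀ h0 h1] at h
    rw [← add_assoc]
    refine le_of_mul_le_mul_right ?_ h0
    calc N p * N (q + 1) * N q = N p * N q * N (q + 1) := by ring
      _ ≤ N (p + q) * N (q + 1) := by gcongr
      _ ≤ N (p + q + 1) * N q := by linarith

/-- If `N_p / N_{p-1} ≤ lam ≤ N_{p+1} / N_p`, then `q ↦ lam ^ q / N_q` is maximal at `p`. -/
theorem pow_div_le_of_ratio (hN : IsWeightSequence N) {lam : ℝ} (hl : 0 ≤ lam) {p : ℕ}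
    (h1 : ∀ q < p, N (q + 1) / N q ≤ lam) (h2 : lam ≤ N (p + 1) / N p) (q : ℕ) :
    lam ^ q / N q ≤ lam ^ p / N p := by
  rcases le_total p q with h | h
  · induction q, h using Nat.le_induction with
    | base => exact le_rfl
    | succ q hq ih =>
      refine le_trans ?_ ih
      have h3 := h2.trans (hN.ratio_monotone hq)
      have hq0 := hN.pos q
      have hq1 := hN.pos (q + 1)
      rw [le_div_iff₀ hq0] at h3
      rw [div_le_div_iff₀ hq1 hq0, pow_succ, mul_assoc]
      gcongr
  · clear h2
    induction p, h using Nat.le_induction with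
    | base => exact le_rfl
    | succ p hp ih =>
      refine (ih fun r hr => h1 r (by omega)).trans ?_
      have h3 := h1 p (by omega)
      have hq0 := hN.pos p
      have hq1 := hN.pos (p + 1)
      rw [div_le_iff₀ hq0] at h3
      rw [div_le_div_iff₀ hq0 hq1, pow_succ, mul_assoc]
      gcongr

end IsWeightSequence

/-! ### Growth of regularity weights. -/

/-- Monotonicity gives `(n - m) a_n ≤ ∑_{m ≤ i < n} a_i`, a Cauchy block of the series; for `n ≥ 2m`
the factor `n - m` is at least `n / 2`. -/
theorem tendsto_mul_of_antitone_summable {a : ℕ → ℝ} (h0 : ∀ n, 0 ≤ a n) (ha : Antitone a)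
    (hs : Summable a) : Filter.Tendsto (fun n : ℕ => n * a n) Filter.atTop (nhds 0) := by
  rw [Metric.tendsto_atTop]
  intro ε hε
  obtain ⟨m, hm⟩ := Metric.tendsto_atTop.1 hs.hasSum.tendsto_sum_nat (ε / 4) (by positivity)
  refine ⟨2 * m, fun n hn => ?_⟩
  have h1 : (n - m : ℕ) * a n ≤ ∑ i ∈ Finset.Ico m n, a i := by
    rw [← Nat.card_Ico, ← nsmul_eq_mul]
    exact Finset.card_nsmul_le_sum _ _ _ fun i hi => ha (Finset.mem_Ico.1 hi).2.le
  rw [Finset.sum_Ico_eq_sub _ (by omega)] at h1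
  have h2 := hm m le_rfl
  have h3 := hm n (by omega)
  rw [Real.dist_eq, abs_lt] at h2 h3
  have h4 : (n : ℝ) ≤ 2 * (n - m : ℕ) := by exact_mod_cast (by omega : n ≤ 2 * (n - m))
  have h5 := h0 n
  rw [Real.dist_eq, sub_zero, abs_of_nonneg (by positivity)]
  nlinarith [mul_le_mul_of_nonneg_right h4 h5]

/-- Condition `(M.5)` makes some power of `M` grow faster than `L ^ n n!` for every `L`. -/
theorem RegularityWeight.exists_pow_mul_factorial_le (M : RegularityWeight) :
    ∃ m : ℕ, 0 < m ∧ ∀ L : ℝ, 0 < L → ∃ c : ℝ, 0 < c ∧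
      ∀ n : ℕ, L ^ n * n.factorial ≤ c * M n ^ (2 * m) := by
  obtain ⟨q, hq, _, _, h⟩ := M.strong
  have hM := M.isWeight
  have hs := (h 1 le_rfl).1
  refine ⟨⌈q⌉₊, Nat.ceil_pos.2 hq, fun L hL => ?_⟩
  -- These quotients decrease by (M.1) and are summable by (M.5), so `n * a n → 0`. Hence `M^q`
  -- eventually grows by a factor of at least `L (n + 1)` at each step, which is the growth of `L^n
  -- n!`.
  set a : ℕ → ℝ := fun i => M i ^ q / M (i + 1) ^ q with ha
  have hpos : ∀ n, 0 < M n ^ q := fun n => Real.rpow_pos_of_pos (hM.pos n) q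
  have ha0 : ∀ n, 0 < a n := fun n => div_pos (hpos _) (hpos _)
  have hanti : Antitone a := by
    refine antitone_nat_of_succ_le fun n => ?_
    simp only [ha]
    rw [← Real.div_rpow (hM.pos _).le (hM.pos _).le, ← Real.div_rpow (hM.pos _).le (hM.pos _).le]
    refine Real.rpow_le_rpow (div_nonneg (hM.pos _).le (hM.pos _).le) ?_ hq.le
    have h1 := hM.ratio_monotone (Nat.le_succ n)
    have := inv_anti₀ (div_pos (hM.pos _) (hM.pos _)) h1
    simpa using this
  have hsum : Summable a := by
    rw [← summable_nat_add_iff 1]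
    refine hs.congr fun i => ?_
    simp only [ha, add_comm, add_left_comm]
  have ht := tendsto_mul_of_antitone_summable (fun n => (ha0 n).le) hanti hsum
  obtain ⟨J, hJ⟩ := (ht.eventually (gt_mem_nhds (show 0 < 1 / (2 * L) by positivity))).exists_forall_of_atTop
  have key : ∃ c : ℝ, 0 < c ∧ ∀ n : ℕ, L ^ n * n.factorial ≤ c * M n ^ q := by
    -- The shift ensures `n ≥ 1`, so that `n + 1 ≤ 2n`; this is what the factor 2 in the threshold
    -- `1 / (2L)` pays for.
    set J' := J + 1
    refine ⟨∑ j ∈ Finset.range (J' + 1), L ^ j * j.factorial / M j ^ q, ?_, ?_⟩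
    · exact Finset.sum_pos (fun j _ => div_pos (by positivity) (hpos j)) ⟨0, by simp⟩
    · have h0 : ∀ n ≤ J', L ^ n * n.factorial ≤
          (∑ j ∈ Finset.range (J' + 1), L ^ j * j.factorial / M j ^ q) * M n ^ q := by
        intro n hn
        rw [← div_le_iff₀ (hpos n)]
        exact Finset.single_le_sum (f := fun j : ℕ => L ^ j * (j.factorial : ℝ) / M j ^ q)
          (fun j _ => (div_pos (by positivity) (hpos j)).le) (Finset.mem_range.2 (by omega))
      have hS : 0 ≤ ∑ j ∈ Finset.range (J' + 1), L ^ j * j.factorial / M j ^ q :=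
        Finset.sum_nonneg fun j _ => (div_pos (by positivity) (hpos j)).le
      set S := ∑ j ∈ Finset.range (J' + 1), L ^ j * j.factorial / M j ^ q
      intro n
      rcases le_total n J' with hn | hn
      · exact h0 n hn
      · induction n, hn using Nat.le_induction with
        | base => exact h0 _ le_rfl
        | succ n hn ih =>
          have h1 := hJ n (by omega)
          simp only [ha] at h1
          have hn1 : (1 : ℝ) ≤ n := by exact_mod_cast (by omega : 1 ≤ n)
          rw [mul_div_assoc', div_lt_div_iff₀ (hpos _) (by positivity)] at h1
          have h2 : L * (n + 1) * M n ^ q ≤ M (n + 1) ^ q := by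
            have := hpos n
            have h3 : L * (n + 1) * M n ^ q ≤ n * M n ^ q * (2 * L) := by
              nlinarith [mul_pos hL this]
            linarith
          rw [pow_succ, Nat.factorial_succ]
          push_cast
          calc L ^ n * L * ((n + 1) * (n.factorial : ℝ))
              = (L * (n + 1)) * (L ^ n * n.factorial) := by ring
            _ ≤ (L * (n + 1)) * (S * M n ^ q) := by gcongr
            _ = S * (L * (n + 1) * M n ^ q) := by ring
            _ ≤ S * M (n + 1) ^ q := mul_le_mul_of_nonneg_left h2 hS
  obtain ⟨c, hc, hcn⟩ := key
  refine ⟨c, hc, fun n => (hcn n).trans (mul_le_mul_of_nonneg_left ?_ hc.le)⟩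
  rw [← Real.rpow_natCast]
  refine Real.rpow_le_rpow_of_exponent_le (hM.one_le n) ?_
  push_cast
  linarith [Nat.le_ceil q]

/-! ### Comparing the associated function with the terms of its supremum. -/

section AssociatedFunction

variable {N : ℕ → ℝ} {ρ : ℝ}

theorem pow_div_le_exp_associatedFunction (hN : ∀ p, 0 < N p) (hρ : 0 ≤ ρ)
    (hb : BddAbove (Set.range fun p : ℕ => Real.posLog (ρ ^ p / N p))) (p : ℕ) :
    ρ ^ p / N p ≤ Real.exp (associatedFunction N ρ) := by
  have h0 : 0 ≤ ρ ^ p / N p := div_nonneg (pow_nonneg hρ p) (hN p).le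
  rcases h0.eq_or_lt with h | h
  · rw [← h]
    positivity
  · rw [← Real.log_le_iff_le_exp h]
    exact (le_max_right 0 _).trans (le_ciSup hb p)

theorem exp_associatedFunction_le (hN : N 0 = 1) (hN' : ∀ p, 0 < N p) (hρ : 0 ≤ ρ) {b : ℝ}
    (h : ∀ p, ρ ^ p / N p ≤ b) : Real.exp (associatedFunction N ρ) ≤ b := by
  -- The term `p = 0` forces `b ≥ 1`, so truncating the logarithm at zero costs nothing.
  have hb : 1 ≤ b := by simpa [hN] using h 0
  rw [← Real.le_log_iff_exp_le (by linarith)]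
  refine ciSup_le fun p => ?_
  rw [← Real.posLog_eq_log (x := b) (by rwa [abs_of_nonneg (by linarith)])]
  exact Real.posLog_le_posLog (div_nonneg (pow_nonneg hρ p) (hN' p).le) (h p)

theorem bddAbove_posLog_of_le (hN : ∀ p, 0 < N p) (hρ : 0 ≤ ρ) {b : ℝ}
    (h : ∀ p, ρ ^ p / N p ≤ b) :
    BddAbove (Set.range fun p : ℕ => Real.posLog (ρ ^ p / N p)) := by
  refine ⟨Real.posLog b, ?_⟩
  rintro _ ⟨p, rfl⟩
  exact Real.posLog_le_posLog (div_nonneg (pow_nonneg hρ p) (hN p).le) (h p)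

end AssociatedFunction

/-! ### Growth of `exp A(ρ)` and changes of scale. -/

namespace DecayWeight

variable (A : DecayWeight)

/-- `exp (A ρ)`, with `A ρ` the associated function. -/
noncomputable def expAssoc (ρ : ℝ) : ℝ := Real.exp (associatedFunction A ρ)

theorem expAssoc_pos (ρ : ℝ) : 0 < A.expAssoc ρ := Real.exp_pos _

theorem one_le_expAssoc (ρ : ℝ) : 1 ≤ A.expAssoc ρ :=
  Real.one_le_exp (A.associatedFunction_nonneg ρ)

theorem expAssoc_mono {ρ ρ' : ℝ} (h0 : 0 ≤ ρ) (h : ρ ≤ ρ') : A.expAssoc ρ ≤ A.expAssoc ρ' :=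
  Real.exp_le_exp.2 (A.associatedFunction_mono h0 h)

theorem expAssoc_le_mul {a b c : ℝ} (ha : 0 ≤ a) (h : a ≤ b + c) :
    A.expAssoc a ≤ A.expAssoc (2 * b) * A.expAssoc (2 * c) := by
  rw [expAssoc, expAssoc, expAssoc, ← Real.exp_add]
  exact Real.exp_le_exp.2 (A.associatedFunction_add_le ha h)

theorem pow_div_le_expAssoc {ρ : ℝ} (hρ : 0 ≤ ρ) (p : ℕ) : ρ ^ p / A p ≤ A.expAssoc ρ :=
  pow_div_le_exp_associatedFunction A.isWeight.pos hρ (A.bddAbove hρ) p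

theorem expAssoc_le {ρ b : ℝ} (hρ : 0 ≤ ρ) (h : ∀ p, ρ ^ p / A p ≤ b) : A.expAssoc ρ ≤ b :=
  exp_associatedFunction_le A.isWeight.zero A.isWeight.pos hρ h

theorem expAssoc_factorialWeight_le {ρ : ℝ} (hρ : 0 ≤ ρ) :
    factorialWeight.expAssoc ρ ≤ Real.exp ρ :=
  factorialWeight.expAssoc_le hρ fun p => Real.pow_div_factorial_le_exp _ hρ p

theorem exists_expAssoc_le_exp : ∃ K L : ℝ, 0 < K ∧ 1 ≤ L ∧ ∀ ρ, 0 ≤ ρ →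
    A.expAssoc ρ ≤ K * Real.exp (L * ρ) := by
  obtain ⟨K, L, hL, h⟩ := A.exists_associatedFunction_le
  refine ⟨Real.exp K, L, Real.exp_pos K, hL, fun ρ hρ => ?_⟩
  refine (Real.exp_le_exp.2 (h ρ hρ)).trans ?_
  rw [Real.exp_add]
  exact mul_le_mul_of_nonneg_left
    (expAssoc_factorialWeight_le (mul_nonneg (zero_le_one.trans hL) hρ)) (Real.exp_pos K).le

/-- Condition (M.2) merges the product of the `i`-th and `j`-th terms into `c (Hρ)^{i+j} / A_{i+j}`;
the suprema over `i` and `j` are then taken separately. -/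
theorem exists_expAssoc_sq_le : ∃ c H : ℝ, 1 ≤ c ∧ 1 ≤ H ∧ ∀ ρ, 0 ≤ ρ →
    A.expAssoc ρ * A.expAssoc ρ ≤ c * A.expAssoc (H * ρ) := by
  obtain ⟨c, H, hc, hH, h⟩ := A.isWeight.stable
  refine ⟨c, H, hc, hH, fun ρ hρ => ?_⟩
  have hE := A.expAssoc_pos ρ
  rw [← le_div_iff₀ hE]
  refine A.expAssoc_le hρ fun i => ?_
  rw [le_div_iff₀ hE, mul_comm]
  rcases (show 0 ≤ ρ ^ i / A i from div_nonneg (pow_nonneg hρ i) (A.isWeight.pos i).le).eq_or_lt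
    with h0 | h0
  · rw [← h0, mul_zero]
    have := A.expAssoc_pos (H * ρ)
    positivity
  rw [← le_div_iff₀ h0]
  refine A.expAssoc_le hρ fun j => ?_
  rw [le_div_iff₀ h0]
  have h1 := h (j + i) i (by omega)
  rw [Nat.add_sub_cancel] at h1
  have hi := A.isWeight.pos i
  have hj := A.isWeight.pos j
  have hij := A.isWeight.pos (j + i)
  refine le_trans ?_ (mul_le_mul_of_nonneg_left
    (A.pow_div_le_expAssoc (show 0 ≤ H * ρ by positivity) (j + i)) (by linarith : 0 ≤ c))
  rw [div_mul_div_comm, mul_div_assoc', div_le_div_iff₀ (by positivity) hij, ← pow_add, mul_pow]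
  calc ρ ^ (j + i) * A (j + i) ≤ ρ ^ (j + i) * (c * H ^ (j + i) * (A j * A i)) := by gcongr
    _ = _ := by ring

theorem exists_one_add_pow_le (n : ℕ) {t : ℝ} (ht : 0 < t) : ∃ C : ℝ, 0 < C ∧ ∀ ρ, 0 ≤ ρ →
    (1 + ρ) ^ n ≤ C * A.expAssoc (t * ρ) := by
  have hA := A.isWeight.pos n
  refine ⟨2 ^ n * (1 + A n / t ^ n), by positivity, fun ρ hρ => ?_⟩
  have h1 := A.one_le_expAssoc (t * ρ)
  -- The single term of index `n` in the supremum already controls the power `ρ^n`.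
  have h2 := A.pow_div_le_expAssoc (show 0 ≤ t * ρ by positivity) n
  rw [div_le_iff₀ hA, mul_pow] at h2
  have h3 : ρ ^ n ≤ A n / t ^ n * A.expAssoc (t * ρ) := by
    rw [div_mul_eq_mul_div, le_div_iff₀ (by positivity)]
    linarith
  have h4 : (1 + ρ) ^ n ≤ 2 ^ n * (1 + ρ ^ n) := by
    rcases le_total ρ 1 with h | h
    · calc (1 + ρ) ^ n ≤ 2 ^ n := by gcongr; linarith
        _ ≤ _ := le_mul_of_one_le_right (by positivity) (by linarith [pow_nonneg hρ n])
    · calc (1 + ρ) ^ n ≤ (2 * ρ) ^ n := by gcongr; linarith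
        _ = 2 ^ n * ρ ^ n := mul_pow _ _ _
        _ ≤ _ := by gcongr; linarith
  refine h4.trans ?_
  rw [mul_assoc]
  gcongr
  nlinarith

/-- The quotient of two weights with a sufficiently large ratio of scales decays faster than
any power. -/
theorem exists_expAssoc_div_le : ∃ H : ℝ, 1 ≤ H ∧ ∀ (n : ℕ) (t : ℝ), 0 < t → ∃ C : ℝ, 0 < C ∧
    ∀ ρ, 0 ≤ ρ → A.expAssoc (t * ρ) / A.expAssoc (H * t * ρ) ≤ C / (1 + ρ) ^ n := by
  obtain ⟨c, H, hc, hH, h⟩ := A.exists_expAssoc_sq_le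
  refine ⟨H, hH, fun n t ht => ?_⟩
  obtain ⟨C, hC, hC'⟩ := A.exists_one_add_pow_le n ht
  refine ⟨c * C, by positivity, fun ρ hρ => ?_⟩
  have h1 := h (t * ρ) (by positivity)
  have h2 := hC' ρ hρ
  have h3 := A.expAssoc_pos (t * ρ)
  have h4 := A.expAssoc_pos (H * t * ρ)
  rw [← mul_assoc] at h1
  rw [div_le_div_iff₀ h4 (by positivity)]
  calc A.expAssoc (t * ρ) * (1 + ρ) ^ n ≤ A.expAssoc (t * ρ) * (C * A.expAssoc (t * ρ)) := by
        gcongr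
    _ = C * (A.expAssoc (t * ρ) * A.expAssoc (t * ρ)) := by ring
    _ ≤ C * (c * A.expAssoc (H * t * ρ)) := by gcongr
    _ = _ := by ring

end DecayWeight

/-! ### Twisted weights -/

section Twisted

variable (A : DecayWeight) {t : ℕ → ℝ}

theorem twistedWeight_pos (ht : IsIncreasingToInfinity t) (p : ℕ) : 0 < twistedWeight A t p :=
  mul_pos (A.isWeight.pos p) (Finset.prod_pos fun j _ => ht.pos j)

theorem twistedWeight_zero : twistedWeight A t 0 = 1 := by
  simp [twistedWeight, A.isWeight.zero]

/-- All but finitely many factors `κ t_j` are at least 1. This is why the twisted associated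
function is dominated by `A(κ ·)` for every `κ`, however small. -/
theorem exists_inv_pow_le_prod (ht : IsIncreasingToInfinity t) {κ : ℝ} (hκ : 0 < κ) :
    ∃ C : ℝ, 0 < C ∧ ∀ p : ℕ, 1 ≤ C * κ ^ p * ∏ j ∈ Finset.Icc 1 p, t j := by
  obtain ⟨J, hJ⟩ := (ht.tendsto.eventually_ge_atTop κ⁻¹).exists_forall_of_atTop
  have hP : ∀ p : ℕ, 0 < κ ^ p * ∏ j ∈ Finset.Icc 1 p, t j := fun p =>
    mul_pos (by positivity) (Finset.prod_pos fun j _ => ht.pos j)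
  refine ⟨∑ p ∈ Finset.range (J + 1), (κ ^ p * ∏ j ∈ Finset.Icc 1 p, t j)⁻¹, ?_, ?_⟩
  · exact Finset.sum_pos (fun p _ => inv_pos.2 (hP p)) ⟨0, by simp⟩
  · have h0 : ∀ p ≤ J, 1 ≤ (∑ p ∈ Finset.range (J + 1), (κ ^ p * ∏ j ∈ Finset.Icc 1 p, t j)⁻¹) *
        κ ^ p * ∏ j ∈ Finset.Icc 1 p, t j := by
      intro p hp
      rw [mul_assoc, ← div_le_iff₀ (hP p), one_div]
      exact Finset.single_le_sum (f := fun p : ℕ => (κ ^ p * ∏ j ∈ Finset.Icc 1 p, t j)⁻¹)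
        (fun j _ => (inv_pos.2 (hP j)).le) (Finset.mem_range.2 (by omega))
    intro p
    rcases le_total p J with hp | hp
    · exact h0 p hp
    · induction p, hp using Nat.le_induction with
      | base => exact h0 J le_rfl
      | succ p hp ih =>
        refine ih.trans ?_
        rw [Finset.prod_Icc_succ_top (by omega), pow_succ]
        have h1 := hJ (p + 1) (by omega)
        rw [inv_le_iff_one_le_mul₀' hκ] at h1
        calc _ = (_ * κ ^ p * ∏ j ∈ Finset.Icc 1 p, t j) * 1 := (mul_one _).symm
          _ ≤ (_ * κ ^ p * ∏ j ∈ Finset.Icc 1 p, t j) * (κ * t (p + 1)) :=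
              mul_le_mul_of_nonneg_left h1 (by linarith)
          _ = _ := by ring

theorem exists_pow_div_twistedWeight_le (ht : IsIncreasingToInfinity t) {κ : ℝ} (hκ : 0 < κ) :
    ∃ C : ℝ, 0 < C ∧ ∀ ρ : ℝ, 0 ≤ ρ → ∀ p,
      ρ ^ p / twistedWeight A t p ≤ C * A.expAssoc (κ * ρ) := by
  obtain ⟨C, hC, h⟩ := exists_inv_pow_le_prod ht hκ
  refine ⟨C, hC, fun ρ hρ p => ?_⟩
  refine le_trans ?_ (mul_le_mul_of_nonneg_left
    (A.pow_div_le_expAssoc (show 0 ≤ κ * ρ by positivity) p) hC.le)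
  have hA := A.isWeight.pos p
  have hT := twistedWeight_pos A ht p
  rw [mul_div_assoc', div_le_div_iff₀ hT hA, mul_pow, twistedWeight]
  calc ρ ^ p * A p = 1 * (ρ ^ p * A p) := (one_mul _).symm
    _ ≤ _ := mul_le_mul_of_nonneg_right (h p) (by positivity)
    _ = _ := by ring

theorem exists_exp_associatedFunction_twistedWeight_le (ht : IsIncreasingToInfinity t) {κ : ℝ}
    (hκ : 0 < κ) : ∃ C : ℝ, 0 < C ∧ ∀ ρ : ℝ, 0 ≤ ρ →
      Real.exp (associatedFunction (twistedWeight A t) ρ) ≤ C * A.expAssoc (κ * ρ) := by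
  obtain ⟨C, hC, h⟩ := exists_pow_div_twistedWeight_le A ht hκ
  exact ⟨C, hC, fun ρ hρ => exp_associatedFunction_le (twistedWeight_zero A)
    (twistedWeight_pos A ht) hρ (h ρ hρ)⟩

/-- A real supremum dominates its terms only if it is bounded above; the comparison with `A` at
scale 1 supplies the bound. -/
theorem pow_div_le_exp_associatedFunction_twistedWeight (ht : IsIncreasingToInfinity t) {ρ : ℝ}
    (hρ : 0 ≤ ρ) (p : ℕ) : ρ ^ p / twistedWeight A t p ≤
      Real.exp (associatedFunction (twistedWeight A t) ρ) := by
  obtain ⟨C, hC, h⟩ := exists_pow_div_twistedWeight_le A ht one_pos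
  exact pow_div_le_exp_associatedFunction (twistedWeight_pos A ht) hρ
    (bddAbove_posLog_of_le (twistedWeight_pos A ht) hρ (h ρ hρ)) p

end Twisted

/-! ### One twisted weight for a family of bounds. -/

/-- A sequence of natural numbers tending to infinity as slowly as prescribed by `K`. -/
theorem exists_slow_sequence (K : ℕ → ℝ) : ∃ ν : ℕ → ℕ, Monotone ν ∧
    Filter.Tendsto ν Filter.atTop Filter.atTop ∧ (∀ j, ν (j + 1) ≤ ν j + 1) ∧
    ∀ j, 0 < ν j → K (ν j) ≤ 2 ^ j := by
  choose r hr using fun n => (pow_unbounded_of_one_lt (K n) (one_lt_two (α := ℝ)))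
  -- `p` is strictly increasing with `K n ≤ 2 ^ p n`, and `ν` is its generalized inverse: `ν j` is
  -- the last `n` with `p n ≤ j`. Strictness of `p` keeps the jumps of `ν` at most 1. If no `n`
  -- qualifies, the value is the default 0, whence the restriction `0 < ν j`.
  set p : ℕ → ℕ := fun n => n + ∑ i ∈ Finset.range (n + 1), r i with hp
  have hps : StrictMono p := strictMono_nat_of_lt_succ fun n => by
    simp only [hp]
    rw [Finset.sum_range_succ _ (n + 1)]
    omega
  have hpK : ∀ n, K n ≤ 2 ^ p n := fun n => (hr n).le.trans (by
    refine pow_le_pow_right₀ one_le_two ?_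
    simp only [hp]
    rw [Finset.sum_range_succ]
    omega)
  have hle : ∀ n j, p n ≤ j → n ≤ Nat.findGreatest (fun n => p n ≤ j) j := fun n j h =>
    Nat.le_findGreatest ((hps.id_le n).trans h) h
  have hsp : ∀ j, Nat.findGreatest (fun n => p n ≤ j) j ≠ 0 →
      p (Nat.findGreatest (fun n => p n ≤ j) j) ≤ j := fun j h =>
    Nat.findGreatest_of_ne_zero (P := fun n => p n ≤ j) rfl h
  have hmono : Monotone fun j => Nat.findGreatest (fun n => p n ≤ j) j := fun i j hij => by
    by_cases h : Nat.findGreatest (fun n => p n ≤ i) i = 0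
    · simp only [h, Nat.zero_le]
    · exact hle _ _ ((hsp i h).trans hij)
  refine ⟨fun j => Nat.findGreatest (fun n => p n ≤ j) j, hmono,
    Filter.tendsto_atTop_atTop.2 fun n => ⟨p n, fun j hj => hle n j hj⟩, fun j => ?_, fun j hj => ?_⟩
  · by_contra hcon
    push Not at hcon
    obtain ⟨m, hm⟩ : ∃ m, Nat.findGreatest (fun n => p n ≤ j + 1) (j + 1) = m + 1 :=
      ⟨_, (Nat.succ_pred_eq_of_pos (by omega)).symm⟩
    have h1 := hsp (j + 1) (by omega)
    rw [hm] at h1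
    have h2 := hps (Nat.lt_succ_self m)
    have h3 := hle m j (by simp only [Nat.succ_eq_add_one] at h2; omega)
    omega
  · exact (hpK _).trans (pow_le_pow_right₀ one_le_two (hsp j hj.ne'))

/-- A family of bounds `K_n exp (A (ρ / n))` is dominated by a single twisted weight. -/
theorem exists_twistedWeight_of_forall_le (A : DecayWeight) (K : ℕ → ℝ) :
    ∃ t : ℕ → ℝ, IsIncreasingToInfinity t ∧ ∀ n₀ : ℕ, 1 ≤ n₀ → ∃ C : ℝ, 0 < C ∧
      ∀ ρ X : ℝ, 0 ≤ ρ → (∀ n : ℕ, n₀ ≤ n → X ≤ K n * A.expAssoc (ρ / n)) →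
        X ≤ C * Real.exp (associatedFunction (twistedWeight A t) ρ) := by
  -- The weight is `t_j = (ν_j + 1) / 2`: the halves absorb the factor `2^{s+1}` that bounds `K` at
  -- index `s + 1`. The argument `n + 2` anticipates a scale `h` that may be as large as `ν_{s+1} +
  -- 2`.
  obtain ⟨ν, hmono, htend, hstep, hK⟩ := exists_slow_sequence fun n => K (n + 2)
  have hν2 : ∀ j, (0 : ℝ) < ((ν j : ℝ) + 1) / 2 := fun j => by positivity
  have ht : IsIncreasingToInfinity fun j => ((ν j : ℝ) + 1) / 2 :=
    { pos := hν2
      monotone := fun i j hij => by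
        have : (ν i : ℝ) ≤ ν j := by exact_mod_cast hmono hij
        simp only
        linarith
      tendsto := by
        refine Filter.Tendsto.atTop_div_const two_pos ?_
        exact Filter.tendsto_atTop_add_const_right _ _
          (tendsto_natCast_atTop_atTop.comp htend) }
  refine ⟨_, ht, fun n₀ hn₀ => ?_⟩
  have hA := A.isWeight
  obtain ⟨P, hP⟩ := (htend.eventually_ge_atTop n₀).exists_forall_of_atTop
  -- Beyond `P` the values of `ν` are at least `n₀`, so the hypothesis applies there. For `ρ < R`
  -- the bound with `n = n₀` and a constant suffices.
  set R : ℝ := ((ν (P + 1) : ℝ) + 1) * (A (P + 1) / A P) with hR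
  refine ⟨1 + |K n₀| * A.expAssoc R, by have := A.expAssoc_pos R; positivity,
    fun ρ X hρ hX => ?_⟩
  have hexp : 1 ≤ Real.exp (associatedFunction
      (twistedWeight A fun j => ((ν j : ℝ) + 1) / 2) ρ) :=
    Real.one_le_exp (Real.iSup_nonneg fun _ => Real.posLog_nonneg)
  have hn₀' : (1 : ℝ) ≤ n₀ := by exact_mod_cast hn₀
  have hER := A.expAssoc_pos R
  by_cases hgood : R ≤ ρ
  -- The thresholds tend to infinity because the quotients of `A` are at least 1, so `ρ` lies
  -- between two consecutive ones.
  · have hex : ∃ s, P ≤ s ∧ ((ν (s + 1) : ℝ) + 1) * (A (s + 1) / A s) ≤ ρ ∧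
        ρ < ((ν (s + 2) : ℝ) + 1) * (A (s + 2) / A (s + 1)) := by
      by_contra! hcon
      have hall : ∀ s, P ≤ s → ((ν (s + 1) : ℝ) + 1) * (A (s + 1) / A s) ≤ ρ := by
        intro s hs
        induction s, hs using Nat.le_induction with
        | base => exact hgood
        | succ s hs ih => exact hcon s hs ih
      obtain ⟨s, hs, hs'⟩ := ((htend.eventually_ge_atTop (⌈ρ⌉₊)).and
        (Filter.eventually_ge_atTop (P + 1))).exists
      obtain ⟨s, rfl⟩ : ∃ r, s = r + 1 := ⟨s - 1, by omega⟩
      have h1 := hall s (by omega)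
      have h2 := hA.ratio_monotone (Nat.zero_le s)
      simp only [zero_add, hA.zero, hA.one, div_one] at h2
      have h3 : ρ ≤ ν (s + 1) := (Nat.le_ceil ρ).trans (by exact_mod_cast hs)
      nlinarith
    obtain ⟨s, hs, h1, h2⟩ := hex
    have hνs : n₀ ≤ ν (s + 1) := hP _ (by omega)
    have hr0 : 0 < A (s + 1) / A s := div_pos (hA.pos _) (hA.pos _)
    have hr1 : 0 < A (s + 2) / A (s + 1) := div_pos (hA.pos _) (hA.pos _)
    have hrm : A (s + 1) / A s ≤ A (s + 2) / A (s + 1) := hA.ratio_monotone (Nat.le_succ s)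
    set v : ℝ := (ν (s + 1) : ℝ) with hv
    have hv0 : 0 ≤ v := Nat.cast_nonneg _
    -- This choice places `ρ / h` between consecutive quotients of `A`, so the supremum defining
    -- `A(ρ / h)` is attained at index `s + 1`. The unit jumps of `ν` keep `h` within `[v + 1, v +
    -- 2]`.
    set h : ℝ := max (v + 1) (ρ / (A (s + 2) / A (s + 1))) with hh
    have hh0 : 0 < h := lt_of_lt_of_le (by linarith) (le_max_left _ _)
    have hh1 : v + 1 ≤ h := le_max_left _ _
    have hh2 : h ≤ v + 2 := by
      refine max_le (by linarith) ?_
      have h3 : (ν (s + 2) : ℝ) ≤ v + 1 := by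
        rw [hv]
        exact_mod_cast hstep (s + 1)
      rw [div_le_iff₀ hr1]
      nlinarith
    have hl1 : A (s + 1) / A s ≤ ρ / h := by
      rw [le_div_iff₀ hh0, mul_comm, ← le_div_iff₀ hr0]
      refine max_le ?_ ?_
      · rwa [le_div_iff₀ hr0]
      · gcongr
    have hl2 : ρ / h ≤ A (s + 2) / A (s + 1) := by
      rw [div_le_iff₀ hh0, mul_comm, ← div_le_iff₀ hr1]
      exact le_max_right _ _
    have hmax := fun q => hA.pow_div_le_of_ratio (div_nonneg hρ hh0.le)
      (p := s + 1) (fun q hq => (hA.ratio_monotone (by omega : q ≤ s)).trans hl1) hl2 q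
    have h4 := hX (ν (s + 1) + 2) (by omega)
    have h5 := hK (s + 1) (by omega)
    have hA1 := hA.pos (s + 1)
    have hprod : ∏ j ∈ Finset.Icc 1 (s + 1), ((ν j : ℝ) + 1) / 2 ≤ ((v + 1) / 2) ^ (s + 1) := by
      calc _ ≤ ∏ j ∈ Finset.Icc 1 (s + 1), (v + 1) / 2 := by
            refine Finset.prod_le_prod (fun j _ => (hν2 j).le) fun j hj => ?_
            exact ht.monotone (Finset.mem_Icc.1 hj).2
        _ = _ := by rw [Finset.prod_const, Nat.card_Icc, Nat.add_sub_cancel]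
    calc X ≤ K (ν (s + 1) + 2) * A.expAssoc (ρ / (ν (s + 1) + 2 : ℕ)) := h4
      _ ≤ 2 ^ (s + 1) * A.expAssoc (ρ / h) := by
          refine mul_le_mul h5 (A.expAssoc_mono (by positivity) ?_) (A.expAssoc_pos _).le
            (by positivity)
          push_cast
          gcongr
      _ ≤ 2 ^ (s + 1) * ((ρ / h) ^ (s + 1) / A (s + 1)) := by
          gcongr
          exact A.expAssoc_le (div_nonneg hρ hh0.le) hmax
      _ ≤ 2 ^ (s + 1) * ((ρ / (v + 1)) ^ (s + 1) / A (s + 1)) := by gcongr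
      _ = ρ ^ (s + 1) / (A (s + 1) * ((v + 1) / 2) ^ (s + 1)) := by
          rw [div_pow ρ, div_pow _ (2 : ℝ)]
          field_simp
      _ ≤ ρ ^ (s + 1) / twistedWeight A (fun j => ((ν j : ℝ) + 1) / 2) (s + 1) := by
          have := twistedWeight_pos A ht (s + 1)
          refine div_le_div_of_nonneg_left (by positivity) this ?_
          unfold twistedWeight
          gcongr
      _ ≤ Real.exp (associatedFunction (twistedWeight A fun j => ((ν j : ℝ) + 1) / 2) ρ) :=
          pow_div_le_exp_associatedFunction_twistedWeight A ht hρ _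
      _ ≤ _ := le_mul_of_one_le_left (Real.exp_pos _).le
          (by linarith [mul_nonneg (abs_nonneg (K n₀)) hER.le])
  · push Not at hgood
    calc X ≤ K n₀ * A.expAssoc (ρ / n₀) := hX n₀ le_rfl
      _ ≤ |K n₀| * A.expAssoc R := by
          refine mul_le_mul (le_abs_self _) (A.expAssoc_mono (by positivity) ?_)
            (A.expAssoc_pos _).le (abs_nonneg _)
          exact (div_le_self hρ hn₀').trans hgood.le
      _ ≤ 1 + |K n₀| * A.expAssoc R := by linarith
      _ ≤ _ := le_mul_of_one_le_right (by positivity) hexp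

/-! ### Iterated partial derivatives along words -/

section Words

variable {d : ℕ}

/-- The partial derivative `∂_{j_1} ⋯ ∂_{j_n} φ` along the word `w = [j_1, …, j_n]`. -/
noncomputable def wordD (w : List (Fin d)) (φ : EuclideanSpace ℝ (Fin d) → ℂ) :
    EuclideanSpace ℝ (Fin d) → ℂ :=
  w.foldr partialD φ

@[simp] theorem wordD_nil (φ : EuclideanSpace ℝ (Fin d) → ℂ) : wordD [] φ = φ := rfl

@[simp] theorem wordD_cons (j : Fin d) (w : List (Fin d)) (φ : EuclideanSpace ℝ (Fin d) → ℂ) :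
    wordD (j :: w) φ = partialD j (wordD w φ) := rfl

theorem wordD_append (v w : List (Fin d)) (φ : EuclideanSpace ℝ (Fin d) → ℂ) :
    wordD (v ++ w) φ = wordD v (wordD w φ) := List.foldr_append

theorem wordD_replicate (n : ℕ) (j : Fin d) (φ : EuclideanSpace ℝ (Fin d) → ℂ) :
    wordD (List.replicate n j) φ = (partialD j)^[n] φ := by
  induction n with
  | zero => rfl
  | succ n ih => rw [List.replicate_succ, wordD_cons, ih, Function.iterate_succ_apply']

/-- The ordered word with `α j` letters `j`. -/
def multiIndexWord (α : Fin d → ℕ) : List (Fin d) :=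
  (List.finRange d).flatMap fun j => List.replicate (α j) j

theorem wordD_multiIndexWord (α : Fin d → ℕ) (φ : EuclideanSpace ℝ (Fin d) → ℂ) :
    wordD (multiIndexWord α) φ = iteratedPartial α φ := by
  unfold multiIndexWord iteratedPartial
  induction List.finRange d with
  | nil => rfl
  | cons j l ih => rw [List.flatMap_cons, wordD_append, wordD_replicate, ih, List.foldr_cons]

theorem length_multiIndexWord (α : Fin d → ℕ) : (multiIndexWord α).length = ∑ j, α j := by
  simp [multiIndexWord, List.length_flatMap, Fin.sum_univ_def]

theorem count_multiIndexWord (α : Fin d → ℕ) (j : Fin d) : (multiIndexWord α).count j = α j := by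
  rw [multiIndexWord, List.count_flatMap]
  have h : (List.count j ∘ fun i => List.replicate (α i) i) = fun i => if i = j then α i else 0 := by
    ext i
    simp [List.count_replicate]
  rw [h, ← Fin.sum_univ_def]
  simp

theorem ContDiff.wordD {φ : EuclideanSpace ℝ (Fin d) → ℂ} (h : ContDiff ℝ ∞ φ)
    (w : List (Fin d)) : ContDiff ℝ ∞ (wordD w φ) := by
  induction w with
  | nil => exact h
  | cons j w ih => exact ih.partialD j

theorem partialD_comm {φ : EuclideanSpace ℝ (Fin d) → ℂ} (h : ContDiff ℝ ∞ φ) (i j : Fin d) :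
    partialD i (partialD j φ) = partialD j (partialD i φ) := by
  ext x
  have hd : Differentiable ℝ (fderiv ℝ φ) :=
    (h.fderiv_right (m := ∞) (by simp)).differentiable (by simp)
  have key : ∀ i j : Fin d, partialD i (partialD j φ) x =
      fderiv ℝ (fderiv ℝ φ) x (EuclideanSpace.single i 1) (EuclideanSpace.single j 1) := by
    intro i j
    change fderiv ℝ (fun y => fderiv ℝ φ y (EuclideanSpace.single j 1)) x _ = _
    rw [fderiv_clm_apply (hd x) (differentiableAt_const _)]
    simp
  rw [key, key]
  have hs : IsSymmSndFDerivAt ℝ φ x := h.contDiffAt.isSymmSndFDerivAt (by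
    simp only [minSmoothness_of_isRCLikeNormedField]
    exact WithTop.coe_le_coe.2 (le_top : (2 : ℕ∞) ≤ ⊤))
  exact hs.eq _ _

theorem wordD_perm {φ : EuclideanSpace ℝ (Fin d) → ℂ} (h : ContDiff ℝ ∞ φ)
    {v w : List (Fin d)} (hp : v.Perm w) : wordD v φ = wordD w φ := by
  induction hp with
  | nil => rfl
  | cons j _ ih => rw [wordD_cons, wordD_cons, ih]
  | swap i j l => simp only [wordD_cons, partialD_comm (h.wordD l)]
  | trans _ _ ih1 ih2 => rw [ih1, ih2]

/-- Partial derivatives of smooth functions commute, so only letter counts matter. Words permit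
inductions that peel off one derivative at a time, with no multi-index binomials. -/
theorem wordD_eq_iteratedPartial {φ : EuclideanSpace ℝ (Fin d) → ℂ} (h : ContDiff ℝ ∞ φ)
    (w : List (Fin d)) : wordD w φ = iteratedPartial (fun j => w.count j) φ := by
  rw [← wordD_multiIndexWord]
  exact wordD_perm h (List.perm_iff_count.2 fun j =>
    (count_multiIndexWord (fun j => w.count j) j).symm)

theorem sum_count_eq_length (w : List (Fin d)) : ∑ j, w.count j = w.length := by
  rw [← length_multiIndexWord]
  exact (List.perm_iff_count.2 fun j => count_multiIndexWord _ j).length_eq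

theorem partialD_add {φ ψ : EuclideanSpace ℝ (Fin d) → ℂ} (hφ : ContDiff ℝ ∞ φ)
    (hψ : ContDiff ℝ ∞ ψ) (j : Fin d) :
    partialD j (φ + ψ) = partialD j φ + partialD j ψ := by
  ext x
  simp only [partialD, Pi.add_apply]
  rw [fderiv_add (hφ.differentiable (by simp) x) (hψ.differentiable (by simp) x)]
  rfl

theorem partialD_sub {φ ψ : EuclideanSpace ℝ (Fin d) → ℂ} (hφ : ContDiff ℝ ∞ φ)
    (hψ : ContDiff ℝ ∞ ψ) (j : Fin d) :
    partialD j (φ - ψ) = partialD j φ - partialD j ψ := by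
  ext x
  simp only [partialD, Pi.sub_apply]
  rw [fderiv_sub (hφ.differentiable (by simp) x) (hψ.differentiable (by simp) x)]
  rfl

theorem partialD_mul {φ ψ : EuclideanSpace ℝ (Fin d) → ℂ} (hφ : ContDiff ℝ ∞ φ)
    (hψ : ContDiff ℝ ∞ ψ) (j : Fin d) :
    partialD j (φ * ψ) = partialD j φ * ψ + φ * partialD j ψ := by
  ext x
  simp only [partialD, Pi.add_apply, Pi.mul_apply]
  rw [fderiv_mul (hφ.differentiable (by simp) x) (hψ.differentiable (by simp) x)]
  simp [mul_comm, add_comm]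

theorem wordD_add {φ ψ : EuclideanSpace ℝ (Fin d) → ℂ} (hφ : ContDiff ℝ ∞ φ)
    (hψ : ContDiff ℝ ∞ ψ) (w : List (Fin d)) :
    wordD w (φ + ψ) = wordD w φ + wordD w ψ := by
  induction w with
  | nil => rfl
  | cons j w ih => simp only [wordD_cons, ih, partialD_add (hφ.wordD w) (hψ.wordD w)]

theorem wordD_sub {φ ψ : EuclideanSpace ℝ (Fin d) → ℂ} (hφ : ContDiff ℝ ∞ φ)
    (hψ : ContDiff ℝ ∞ ψ) (w : List (Fin d)) :
    wordD w (φ - ψ) = wordD w φ - wordD w ψ := by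
  induction w with
  | nil => rfl
  | cons j w ih => simp only [wordD_cons, ih, partialD_sub (hφ.wordD w) (hψ.wordD w)]

theorem norm_wordD_reflect {φ : EuclideanSpace ℝ (Fin d) → ℂ} (h : ContDiff ℝ ∞ φ)
    (w : List (Fin d)) (x y : EuclideanSpace ℝ (Fin d)) :
    ‖wordD w (fun z => φ (x - z)) y‖ = ‖wordD w φ (x - y)‖ := by
  have hc : ContDiff ℝ ∞ fun z => φ (x - z) := h.comp (contDiff_const.sub contDiff_id)
  rw [wordD_eq_iteratedPartial h, wordD_eq_iteratedPartial hc, norm_iteratedPartial_reflect]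

/-- Pointwise Denjoy–Carleman bounds are stable under products. -/
theorem norm_wordD_mul_le {N : ℕ → ℝ} (hN : IsWeightSequence N)
    {u v : EuclideanSpace ℝ (Fin d) → ℂ} (hu : ContDiff ℝ ∞ u) (hv : ContDiff ℝ ∞ v)
    {x : EuclideanSpace ℝ (Fin d)} {U V a b : ℝ} (hU : 0 ≤ U) (hV : 0 ≤ V)
    (ha : 0 ≤ a) (hb : 0 ≤ b)
    (hux : ∀ w, ‖wordD w u x‖ ≤ U * (a ^ w.length * N w.length))
    (hvx : ∀ w, ‖wordD w v x‖ ≤ V * (b ^ w.length * N w.length)) (w : List (Fin d)) :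
    ‖wordD w (u * v) x‖ ≤ U * V * ((a + b) ^ w.length * N w.length) := by
  -- The generalization records the derivatives already handed to each factor. The Leibniz rule for
  -- the last letter sends it to `u` at cost `a` or to `v` at cost `b`, whence `a + b`; once no
  -- letters remain, `N_p N_q ≤ N_{p+q}` merges the weights.
  have key : ∀ w β γ : List (Fin d), ‖wordD w (wordD β u * wordD γ v) x‖ ≤
      U * V * ((a + b) ^ w.length * (a ^ β.length * b ^ γ.length) *
        N (w.length + β.length + γ.length)) := by
    intro w
    induction w using List.reverseRecOn with
    | nil =>
      intro β γ
      simp only [wordD_nil, Pi.mul_apply, norm_mul, List.length_nil, pow_zero, one_mul, zero_add]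
      have h1 := hN.pos β.length
      have h2 := hN.pos γ.length
      calc _ ≤ (U * (a ^ β.length * N β.length)) * (V * (b ^ γ.length * N γ.length)) :=
            mul_le_mul (hux β) (hvx γ) (norm_nonneg _) (by positivity)
        _ = U * V * ((a ^ β.length * b ^ γ.length) * (N β.length * N γ.length)) := by ring
        _ ≤ _ := by
            gcongr
            exact hN.mul_le_add _ _
    | append_singleton w j ih =>
      intro β γ
      have c1 : ContDiff ℝ ∞ (partialD j (wordD β u) * wordD γ v) :=
        ((hu.wordD β).partialD j).mul (hv.wordD γ)
      have c2 : ContDiff ℝ ∞ (wordD β u * partialD j (wordD γ v)) :=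
        (hu.wordD β).mul ((hv.wordD γ).partialD j)
      rw [wordD_append, wordD_cons, wordD_nil, partialD_mul (hu.wordD β) (hv.wordD γ),
        wordD_add c1 c2, Pi.add_apply]
      have h1 := ih (j :: β) γ
      have h2 := ih β (j :: γ)
      simp only [wordD_cons, List.length_cons, List.length_append, List.length_nil, zero_add] at *
      have e1 : w.length + (β.length + 1) + γ.length = w.length + 1 + β.length + γ.length := by omega
      have e2 : w.length + β.length + (γ.length + 1) = w.length + 1 + β.length + γ.length := by omega
      rw [e1] at h1
      rw [e2] at h2
      refine (norm_add_le _ _).trans ((add_le_add h1 h2).trans (le_of_eq ?_))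
      ring
  simpa using key w [] []

theorem norm_wordD_prod_le {N : ℕ → ℝ} (hN : IsWeightSequence N) {ι : Type*} (s : Finset ι)
    {u : ι → EuclideanSpace ℝ (Fin d) → ℂ} (hu : ∀ i, ContDiff ℝ ∞ (u i))
    {x : EuclideanSpace ℝ (Fin d)} {U : ι → ℝ} {a : ℝ} (hU : ∀ i, 0 ≤ U i) (ha : 0 ≤ a)
    (hux : ∀ i w, ‖wordD w (u i) x‖ ≤ U i * (a ^ w.length * N w.length)) (w : List (Fin d)) :
    ‖wordD w (∏ i ∈ s, u i) x‖ ≤ (∏ i ∈ s, U i) * ((s.card * a) ^ w.length * N w.length) := by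
  classical
  induction s using Finset.induction_on generalizing w with
  | empty =>
    rcases w with _ | ⟨j, w⟩
    · simp [hN.zero]
    -- For the empty product the scale `card * a` is zero, so the claim for a nonempty word says
    -- that derivatives of the constant 1 vanish.
    · have h0 : ∀ (v : List (Fin d)) (j : Fin d),
          wordD (j :: v) (1 : EuclideanSpace ℝ (Fin d) → ℂ) = 0 := by
        intro v
        induction v with
        | nil =>
          intro j
          ext x
          simp only [wordD_cons, wordD_nil, partialD]
          rw [show (1 : EuclideanSpace ℝ (Fin d) → ℂ) = fun _ => (1 : ℂ) from rfl]
          simp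
        | cons i v ih =>
          intro j
          ext x
          rw [wordD_cons, ih]
          simp only [partialD]
          rw [show (0 : EuclideanSpace ℝ (Fin d) → ℂ) = fun _ => (0 : ℂ) from rfl]
          simp
      rw [Finset.prod_empty, h0]
      simp
  | insert i s hi ih =>
    rw [Finset.prod_insert hi, Finset.prod_insert hi, Finset.card_insert_of_notMem hi]
    have hs : ContDiff ℝ ∞ (∏ i ∈ s, u i) := by
      rw [Finset.prod_fn]
      exact contDiff_prod fun i _ => hu i
    refine (norm_wordD_mul_le hN (hu i) hs (hU i) (Finset.prod_nonneg fun i _ => hU i) ha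
      (by positivity) (hux i) ih w).trans (le_of_eq ?_)
    push_cast
    ring

end Words

/-! ### Bounds in the steps -/

section StepBounds

variable {d : ℕ} {M : RegularityWeight} {A : DecayWeight} {h C : ℝ}
  {φ : EuclideanSpace ℝ (Fin d) → ℂ}

theorem norm_wordD_le_of_gsTerm_le (hh : 0 < h) (hφ : ContDiff ℝ ∞ φ)
    (hC : ∀ i, gsTerm M A h φ i ≤ C) (w : List (Fin d)) (x : EuclideanSpace ℝ (Fin d)) :
    ‖wordD w φ x‖ ≤ C * (A.expAssoc (h * ‖x‖))⁻¹ * ((h⁻¹) ^ w.length * M w.length) := by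
  have h1 := hC (fun j => w.count j, x)
  simp only [gsTerm, ← wordD_eq_iteratedPartial hφ, sum_count_eq_length] at h1
  have hM := M.isWeight.pos w.length
  have hE := A.expAssoc_pos (h * ‖x‖)
  change h ^ w.length * (A.expAssoc (h * ‖x‖) * ‖wordD w φ x‖) / M w.length ≤ C at h1
  rw [div_le_iff₀ hM, ← mul_assoc, mul_comm, ← le_div_iff₀ (by positivity)] at h1
  refine h1.trans (le_of_eq ?_)
  rw [inv_pow]
  field_simp

theorem gsTerm_le_of_norm_wordD_le (hh : 0 < h)
    (hC : ∀ w x, ‖wordD w φ x‖ ≤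
      C * (A.expAssoc (h * ‖x‖))⁻¹ * ((h⁻¹) ^ w.length * M w.length)) (i) :
    gsTerm M A h φ i ≤ C := by
  obtain ⟨α, x⟩ := i
  have h1 := hC (multiIndexWord α) x
  rw [wordD_multiIndexWord, length_multiIndexWord] at h1
  have hM := M.isWeight.pos (∑ j, α j)
  have hE := A.expAssoc_pos (h * ‖x‖)
  change h ^ (∑ j, α j) * (A.expAssoc (h * ‖x‖) * ‖iteratedPartial α φ x‖) / M (∑ j, α j) ≤ C
  rw [div_le_iff₀ hM, ← mul_assoc, mul_comm, ← le_div_iff₀ (by positivity)]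
  refine h1.trans (le_of_eq ?_)
  rw [inv_pow]
  field_simp

/-- A member of the step, as an element of the Banach space. -/
def GSStep.mk {h : {h : ℝ // 0 < h}} (φ : EuclideanSpace ℝ (Fin d) → ℂ)
    (hφ : φ ∈ gsStepSubmodule d M A h) : GSStep d M A h := ⟨φ, hφ⟩

theorem GSStep.gsTerm_le_norm {h : {h : ℝ // 0 < h}} (φ : GSStep d M A h) (i) :
    gsTerm M A h φ.1 i ≤ ‖φ‖ := le_ciSup φ.2.2 i

theorem GSStep.norm_le {h : {h : ℝ // 0 < h}} (φ : GSStep d M A h)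
    (hC : ∀ i, gsTerm M A h φ.1 i ≤ C) : ‖φ‖ ≤ C :=
  ciSup_le hC

theorem GSStep.norm_wordD_le {h : {h : ℝ // 0 < h}} (φ : GSStep d M A h) (w : List (Fin d))
    (x : EuclideanSpace ℝ (Fin d)) :
    ‖wordD w φ.1 x‖ ≤ ‖φ‖ * (A.expAssoc (h * ‖x‖))⁻¹ * ((h : ℝ)⁻¹ ^ w.length * M w.length) :=
  norm_wordD_le_of_gsTerm_le h.2 φ.2.1 φ.gsTerm_le_norm w x

end StepBounds

/-! ### Completeness of the steps -/

section Completeness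

variable {d : ℕ}

/-- The linear form with prescribed partial derivatives. -/
noncomputable def gradientMap (d : ℕ) : (Fin d → ℂ) →L[ℝ] (EuclideanSpace ℝ (Fin d) →L[ℝ] ℂ) :=
  ∑ j, (ContinuousLinearMap.smulRightL ℝ (EuclideanSpace ℝ (Fin d)) ℂ
    (EuclideanSpace.proj j)).comp (ContinuousLinearMap.proj j)

theorem gradientMap_apply (v : Fin d → ℂ) (x : EuclideanSpace ℝ (Fin d)) :
    gradientMap d v x = ∑ j, (x j : ℂ) * v j := by
  simp [gradientMap]

theorem fderiv_eq_gradientMap (φ : EuclideanSpace ℝ (Fin d) → ℂ) (x : EuclideanSpace ℝ (Fin d)) :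
    fderiv ℝ φ x = gradientMap d fun j => partialD j φ x := by
  ext y
  have hy : y = ∑ j, y j • EuclideanSpace.single j (1 : ℝ) := by
    ext i
    simp [Pi.single_apply]
  conv_lhs => rw [hy]
  rw [map_sum, gradientMap_apply]
  simp [partialD]

/-- `gradientMap` rebuilds the total derivative from the partial ones, so uniform convergence of the
partials allows differentiation under the limit. Indexing by words makes the family of limits closed
under differentiation, and smoothness follows by induction on the order. -/
theorem wordD_of_tendstoUniformly {F : ℕ → EuclideanSpace ℝ (Fin d) → ℂ}
    (hF : ∀ n, ContDiff ℝ ∞ (F n)) {G : List (Fin d) → EuclideanSpace ℝ (Fin d) → ℂ}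
    (hG : ∀ w, TendstoUniformly (fun n => wordD w (F n)) (G w) Filter.atTop) :
    ContDiff ℝ ∞ (G []) ∧ ∀ w, wordD w (G []) = G w := by
  have hder : ∀ w x, HasFDerivAt (G w) (gradientMap d fun j => G (j :: w) x) x := by
    intro w
    refine hasFDerivAt_of_tendstoUniformly (𝕜 := ℝ) (l := Filter.atTop)
      (f := fun n => wordD w (F n)) (f' := fun n x => gradientMap d fun j => wordD (j :: w) (F n) x)
      ?_ (fun n x => ?_) fun x => (hG w).tendsto_at x
    · refine (gradientMap d).uniformContinuous.comp_tendstoUniformly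
        (F := fun n x j => wordD (j :: w) (F n) x) (f := fun x j => G (j :: w) x) ?_
      rw [Metric.tendstoUniformly_iff]
      intro ε hε
      have h1 := fun j => (Metric.tendstoUniformly_iff.1 (hG (j :: w))) ε hε
      filter_upwards [Filter.eventually_all.2 h1] with n hn x
      rw [dist_pi_lt_iff hε]
      exact fun j => hn j x
    · have := (((hF n).wordD w).differentiable (by simp) x).hasFDerivAt
      rwa [fderiv_eq_gradientMap] at this
  have hcd : ∀ n : ℕ, ∀ w, ContDiff ℝ n (G w) := by
    intro n
    induction n with
    | zero =>
      intro w
      exact contDiff_zero.2 (continuous_iff_continuousAt.2 fun x => (hder w x).continuousAt)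
    | succ n ih =>
      intro w
      refine (contDiff_succ_iff_hasFDerivAt (n := n)).2 ⟨_, ?_, hder w⟩
      exact (gradientMap d).contDiff.comp (contDiff_pi.2 fun j => ih (j :: w))
  refine ⟨contDiff_infty.2 fun n => hcd n [], fun w => ?_⟩
  induction w with
  | nil => rfl
  | cons j w ih =>
    ext x
    rw [wordD_cons, ih, partialD, (hder w x).fderiv, gradientMap_apply]
    simp [apply_ite Complex.ofReal]

variable {M : RegularityWeight} {A : DecayWeight} {h : {h : ℝ // 0 < h}}

theorem GSStep.norm_wordD_sub_le (φ ψ : GSStep d M A h) (w : List (Fin d))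
    (x : EuclideanSpace ℝ (Fin d)) :
    ‖wordD w φ.1 x - wordD w ψ.1 x‖ ≤ ‖φ - ψ‖ * ((h : ℝ)⁻¹ ^ w.length * M w.length) := by
  have h1 := (φ - ψ).norm_wordD_le w x
  have h2 : (φ - ψ).1 = φ.1 - ψ.1 := rfl
  rw [h2, wordD_sub φ.2.1 ψ.2.1, Pi.sub_apply] at h1
  refine h1.trans ?_
  have h3 : (A.expAssoc (h * ‖x‖))⁻¹ ≤ 1 := inv_le_one_of_one_le₀ (A.one_le_expAssoc _)
  have hM := M.isWeight.pos w.length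
  have hh : (0 : ℝ) < (h : ℝ)⁻¹ := inv_pos.2 h.2
  gcongr
  exact mul_le_of_le_one_right (norm_nonneg _) h3

/-- All derivatives of a Cauchy sequence converge uniformly. Passing to the pointwise limit in the
Cauchy estimate bounds `σ_h` of the difference to the limit, which gives both membership and
convergence. -/
instance : CompleteSpace (GSStep d M A h) := by
  refine Metric.complete_of_cauchySeq_tendsto fun u hu => ?_
  have hh : (0 : ℝ) < (h : ℝ)⁻¹ := inv_pos.2 h.2
  have hc : ∀ w : List (Fin d), 0 < (h : ℝ)⁻¹ ^ w.length * M w.length := fun w =>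
    mul_pos (by positivity) (M.isWeight.pos _)
  have hunif : ∀ w, UniformCauchySeqOn (fun n => wordD w (u n).1) Filter.atTop Set.univ := by
    intro w
    rw [Metric.uniformCauchySeqOn_iff]
    intro ε hε
    obtain ⟨n₀, hn₀⟩ := Metric.cauchySeq_iff.1 hu _ (div_pos hε (hc w))
    refine ⟨n₀, fun m hm n hn x _ => ?_⟩
    have h1 := hn₀ m hm n hn
    rw [dist_eq_norm, lt_div_iff₀ (hc w)] at h1
    rw [dist_eq_norm]
    exact ((u m).norm_wordD_sub_le (u n) w x).trans_lt h1
  have hlim : ∀ w x, ∃ y, Filter.Tendsto (fun n => wordD w (u n).1 x) Filter.atTop (nhds y) :=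
    fun w x => cauchySeq_tendsto_of_complete ((hunif w).cauchySeq (Set.mem_univ x))
  choose G hG using hlim
  have hGu : ∀ w, TendstoUniformly (fun n => wordD w (u n).1) (G w) Filter.atTop := fun w => by
    rw [← tendstoUniformlyOn_univ]
    exact (hunif w).tendstoUniformlyOn_of_tendsto fun x _ => hG w x
  obtain ⟨hG1, hG2⟩ := wordD_of_tendstoUniformly (fun n => (u n).2.1) hGu
  have key : ∀ ε : ℝ, ∀ n, (∀ m ≥ n, ‖u n - u m‖ ≤ ε) →
      ∀ i, gsTerm M A h ((u n).1 - G []) i ≤ ε := by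
    intro ε n hn
    refine gsTerm_le_of_norm_wordD_le h.2 fun w x => ?_
    rw [wordD_sub (u n).2.1 hG1, hG2, Pi.sub_apply]
    refine le_of_tendsto ((tendsto_const_nhds.sub (hG w x)).norm)
      (Filter.eventually_atTop.2 ⟨n, fun m hm => ?_⟩)
    have h1 := (u n - u m).norm_wordD_le w x
    have h2 : (u n - u m).1 = (u n).1 - (u m).1 := rfl
    rw [h2, wordD_sub (u n).2.1 (u m).2.1, Pi.sub_apply] at h1
    refine h1.trans ?_
    have hE := A.expAssoc_pos (h * ‖x‖)
    have hcw := hc w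
    have h3 := hn m hm
    gcongr
  have hmem : G [] ∈ gsStepSubmodule d M A h := by
    obtain ⟨n, hn⟩ := Metric.cauchySeq_iff'.1 hu 1 one_pos
    have h1 : (u n).1 - G [] ∈ gsStepSubmodule d M A h := by
      refine ⟨(u n).2.1.sub hG1, 1, ?_⟩
      rintro _ ⟨i, rfl⟩
      refine key 1 n (fun m hm => ?_) i
      rw [← dist_eq_norm, dist_comm]
      exact (hn m hm).le
    have h2 := Submodule.sub_mem _ (u n).2 h1
    simpa using h2
  refine ⟨GSStep.mk (G []) hmem, Metric.tendsto_atTop.2 fun ε hε => ?_⟩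
  obtain ⟨n₀, hn₀⟩ := Metric.cauchySeq_iff.1 hu (ε / 2) (by positivity)
  refine ⟨n₀, fun n hn => ?_⟩
  rw [dist_eq_norm]
  refine lt_of_le_of_lt (GSStep.norm_le _ (key (ε / 2) n fun m hm => ?_)) (by linarith)
  rw [← dist_eq_norm]
  exact (hn₀ n hn m (le_trans hn hm)).le

theorem GSStep.norm_apply_le (φ : GSStep d M A h) (x : EuclideanSpace ℝ (Fin d)) :
    ‖φ.1 x‖ ≤ ‖φ‖ := by
  have := φ.norm_wordD_sub_le 0 [] x
  have h0 : wordD [] (0 : GSStep d M A h).1 x = 0 := rfl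
  rw [h0] at this
  simpa [M.isWeight.zero] using this

/-- Evaluation at a point, as a continuous linear functional on a step. -/
noncomputable def GSStep.evalCLM (x : EuclideanSpace ℝ (Fin d)) : GSStep d M A h →L[ℂ] ℂ :=
  LinearMap.mkContinuous
    { toFun := fun φ => φ.1 x
      map_add' := fun _ _ => rfl
      map_smul' := fun _ _ => rfl } 1 fun φ =>
      (φ.norm_apply_le x).trans_eq (one_mul _).symm

end Completeness

/-! ### A one-dimensional partition of unity -/

section StripBounds

theorem norm_pow_succ_sub_pow_succ_le {a b : ℂ} {τ : ℝ} (ha : ‖a‖ ≤ τ) (hb : ‖b‖ ≤ τ) (n : ℕ) :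
    ‖a ^ (n + 1) - b ^ (n + 1)‖ ≤ (n + 1) * τ ^ n * ‖a - b‖ := by
  have hτ : 0 ≤ τ := (norm_nonneg a).trans ha
  induction n with
  | zero => simp
  | succ n ih =>
    have h1 : a ^ (n + 1 + 1) - b ^ (n + 1 + 1) =
        a * (a ^ (n + 1) - b ^ (n + 1)) + (a - b) * b ^ (n + 1) := by ring
    rw [h1]
    refine (norm_add_le _ _).trans ?_
    rw [norm_mul, norm_mul, norm_pow]
    calc _ ≤ τ * ((n + 1) * τ ^ n * ‖a - b‖) + ‖a - b‖ * τ ^ (n + 1) := by gcongr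
      _ = _ := by
          push_cast
          ring

/-- In a horizontal strip, `exp (-ζ ^ N)` with `N` even decays like `exp (-|ζ| ^ N / 2)`. -/
theorem exists_norm_exp_neg_pow_le {m : ℕ} (hm : 0 < m) (R : ℝ) : ∃ C : ℝ, 0 < C ∧
    ∀ ζ : ℂ, |ζ.im| ≤ R → ‖Complex.exp (-ζ ^ (2 * m))‖ ≤ C * Real.exp (-(‖ζ‖ ^ (2 * m) / 2)) := by
  obtain ⟨n, hn⟩ : ∃ n, 2 * m = n + 1 := ⟨2 * m - 1, by omega⟩
  set K : ℝ := 2 * (n + 1) * |R| * (4 * (n + 1) * |R|) ^ n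
  refine ⟨Real.exp K, Real.exp_pos K, fun ζ hζ => ?_⟩
  rw [Complex.norm_exp, ← Real.exp_add, Real.exp_le_exp, Complex.neg_re]
  have hR : |ζ.im| ≤ |R| := hζ.trans (le_abs_self R)
  have h1 : ‖((ζ.re : ℝ) : ℂ)‖ ≤ ‖ζ‖ := by
    rw [Complex.norm_real]
    exact Complex.abs_re_le_norm ζ
  have h2 : ζ - (ζ.re : ℂ) = (ζ.im : ℂ) * Complex.I := by
    apply Complex.ext <;> simp
  have h3 := norm_pow_succ_sub_pow_succ_le le_rfl h1 n
  rw [h2, norm_mul, Complex.norm_I, mul_one, Complex.norm_real, Real.norm_eq_abs, ← hn] at h3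
  have h4 : ‖ζ ^ (2 * m) - (ζ.re : ℂ) ^ (2 * m)‖ ≤ (n + 1) * ‖ζ‖ ^ n * |R| :=
    h3.trans (by gcongr)
  have h5 : ((ζ.re : ℂ) ^ (2 * m)) = ((ζ.re ^ (2 * m) : ℝ) : ℂ) := by push_cast; rfl
  rw [h5] at h4
  have h6 : 0 ≤ ζ.re ^ (2 * m) := (even_two_mul m).pow_nonneg _
  have h7 := (Complex.abs_re_le_norm _).trans h4
  rw [Complex.sub_re, Complex.ofReal_re, abs_le] at h7
  have h8 : ‖ζ‖ ^ (2 * m) ≤ ζ.re ^ (2 * m) + (n + 1) * ‖ζ‖ ^ n * |R| := by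
    have h9 := (norm_sub_norm_le _ _).trans h4
    rw [Complex.norm_real, Real.norm_of_nonneg h6, norm_pow] at h9
    linarith
  -- Replacing `ζ` by its real part costs lower-order terms of degree `n = 2m - 1`: for large `‖ζ‖`
  -- they are absorbed by half of the leading power, otherwise by `K`.
  have h10 : 2 * (n + 1) * ‖ζ‖ ^ n * |R| ≤ ‖ζ‖ ^ (2 * m) / 2 + K := by
    rcases le_total ‖ζ‖ (4 * (n + 1) * |R|) with h | h
    · have : 2 * (n + 1) * ‖ζ‖ ^ n * |R| ≤ K := by
        calc _ ≤ 2 * (n + 1) * (4 * (n + 1) * |R|) ^ n * |R| := by gcongr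
          _ = K := by ring
      have h11 : 0 ≤ ‖ζ‖ ^ (2 * m) := by positivity
      linarith
    · have hK : 0 ≤ K := by positivity
      rw [hn, pow_succ]
      have := mul_le_mul_of_nonneg_left h (pow_nonneg (norm_nonneg ζ) n)
      linarith
  linarith [h7.1]

/-- Raised to the power `2m`, with `y = m τ^{2m} / 2`, the left side becomes `(2/m)^n y^n e^{-y} ≤
(2/m)^n n!`. The factorial growth of `M^{2m}` then applies with `L = (2/m) / ε^{2m}`. -/
theorem RegularityWeight.exists_pow_mul_exp_le (M : RegularityWeight) : ∃ m : ℕ, 0 < m ∧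
    ∀ ε : ℝ, 0 < ε → ∃ C : ℝ, 0 < C ∧ ∀ (n : ℕ) (τ : ℝ), 0 ≤ τ →
      τ ^ n * Real.exp (-(τ ^ (2 * m) / 4)) ≤ C * (ε ^ n * M n) := by
  obtain ⟨m, hm, h⟩ := M.exists_pow_mul_factorial_le
  refine ⟨m, hm, fun ε hε => ?_⟩
  have hm' : (0 : ℝ) < m := by exact_mod_cast hm
  obtain ⟨c, hc, hcn⟩ := h (2 / m / ε ^ (2 * m)) (by positivity)
  refine ⟨max 1 c, by positivity, fun n τ hτ => ?_⟩
  have hM := M.isWeight.pos n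
  have hmax : (0 : ℝ) < max 1 c := by positivity
  refine le_of_pow_le_pow_left₀ (n := 2 * m) (by omega) (by positivity) ?_
  set y : ℝ := m * τ ^ (2 * m) / 2 with hy
  have hy0 : 0 ≤ y := by positivity
  have h1 : (τ ^ n * Real.exp (-(τ ^ (2 * m) / 4))) ^ (2 * m) =
      (2 / m) ^ n * (y ^ n * Real.exp (-y)) := by
    rw [mul_pow, ← Real.exp_nat_mul, ← mul_assoc, ← mul_pow]
    congr 1
    · rw [← pow_mul, mul_comm n, pow_mul]
      congr 1
      rw [hy]
      field_simp
    · congr 1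
      rw [hy]
      push_cast
      ring
  have h2 : y ^ n * Real.exp (-y) ≤ n.factorial := by
    have h3 := Real.pow_div_factorial_le_exp y hy0 n
    rw [div_le_iff₀ (by positivity)] at h3
    rw [Real.exp_neg, ← div_eq_mul_inv, div_le_iff₀ (Real.exp_pos y)]
    linarith
  have h4 := hcn n
  rw [div_pow, div_mul_eq_mul_div, div_le_iff₀ (by positivity)] at h4
  rw [h1]
  calc (2 / m : ℝ) ^ n * (y ^ n * Real.exp (-y)) ≤ (2 / m : ℝ) ^ n * n.factorial := by gcongr
    _ ≤ c * M n ^ (2 * m) * (ε ^ (2 * m)) ^ n := h4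
    _ = c * (ε ^ n * M n) ^ (2 * m) := by
        rw [mul_pow, ← pow_mul, ← pow_mul, mul_comm n]
        ring
    _ ≤ max 1 c ^ (2 * m) * (ε ^ n * M n) ^ (2 * m) := by
        gcongr
        exact (le_max_right 1 c).trans (le_self_pow₀ (le_max_left 1 c) (by omega))
    _ = _ := (mul_pow _ _ _).symm

/-- The integrand of the `n`-th derivative of the Fourier transform of `exp (-ζ ^ (2 m))`. -/
noncomputable def fourierIntegrand (m n : ℕ) (x : ℝ) (ζ : ℂ) : ℂ :=
  Complex.exp (-2 * Real.pi * Complex.I * x * ζ) *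
    ((-2 * Real.pi * Complex.I * ζ) ^ n * Complex.exp (-ζ ^ (2 * m)))

theorem differentiable_fourierIntegrand (m n : ℕ) (x : ℝ) :
    Differentiable ℂ (fourierIntegrand m n x) := by
  unfold fourierIntegrand
  fun_prop

/-- The strip bound `exp (-|ζ|^{2m} / 2)` is split in two halves: one turns `|ζ|^n` into `ε^n M_n`,
the other yields an integrable factor. -/
theorem exists_norm_fourierIntegrand_le (M : RegularityWeight) : ∃ m : ℕ, 0 < m ∧
    ∀ R ε : ℝ, 0 < ε → ∃ C : ℝ, 0 < C ∧ ∀ (n : ℕ) (x : ℝ) (ζ : ℂ), |ζ.im| ≤ R →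
      ‖fourierIntegrand m n x ζ‖ ≤
        C * (ε ^ n * M n) * Real.exp (2 * Real.pi * x * ζ.im) * (1 + ζ.re ^ 2)⁻¹ := by
  obtain ⟨m, hm, h⟩ := M.exists_pow_mul_exp_le
  refine ⟨m, hm, fun R ε hε => ?_⟩
  have hpi := Real.pi_pos
  obtain ⟨C₁, hC₁, h1⟩ := exists_norm_exp_neg_pow_le hm R
  obtain ⟨C₂, hC₂, h2⟩ := h (ε / (2 * Real.pi)) (by positivity)
  obtain ⟨C₃, hC₃, h3⟩ := h 1 one_pos
  have hM2 := M.isWeight.pos 2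
  refine ⟨C₁ * C₂ * (C₃ * (1 + M 2)), by positivity, fun n x ζ hζ => ?_⟩
  have hM := M.isWeight.pos n
  have h4 := h1 ζ hζ
  have h5 := h2 n ‖ζ‖ (norm_nonneg ζ)
  have h6 : Real.exp (-(‖ζ‖ ^ (2 * m) / 4)) ≤ C₃ * (1 + M 2) * (1 + ζ.re ^ 2)⁻¹ := by
    have h7 := h3 0 ‖ζ‖ (norm_nonneg ζ)
    have h8 := h3 2 ‖ζ‖ (norm_nonneg ζ)
    simp only [pow_zero, one_mul, M.isWeight.zero, one_pow] at h7 h8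
    rw [← div_eq_mul_inv, le_div_iff₀ (by positivity)]
    have h9 : ζ.re ^ 2 ≤ ‖ζ‖ ^ 2 := by
      rw [← sq_abs]
      gcongr
      exact Complex.abs_re_le_norm ζ
    have := mul_le_mul_of_nonneg_right h9 (Real.exp_pos (-(‖ζ‖ ^ (2 * m) / 4))).le
    linarith
  have h10 : ‖Complex.exp (-2 * Real.pi * Complex.I * x * ζ)‖ = Real.exp (2 * Real.pi * x * ζ.im) := by
    rw [Complex.norm_exp]
    congr 1
    simp [Complex.mul_re, Complex.mul_im]
  have h11 : ‖(-2 * Real.pi * Complex.I * ζ) ^ n‖ = (2 * Real.pi) ^ n * ‖ζ‖ ^ n := by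
    simp [norm_pow, mul_pow, abs_of_pos hpi]
  rw [fourierIntegrand, norm_mul, norm_mul, h10, h11]
  calc _ ≤ Real.exp (2 * Real.pi * x * ζ.im) * ((2 * Real.pi) ^ n * ‖ζ‖ ^ n *
        (C₁ * Real.exp (-(‖ζ‖ ^ (2 * m) / 2)))) := by gcongr
    _ = Real.exp (2 * Real.pi * x * ζ.im) * ((2 * Real.pi) ^ n * C₁ *
        ((‖ζ‖ ^ n * Real.exp (-(‖ζ‖ ^ (2 * m) / 4))) * Real.exp (-(‖ζ‖ ^ (2 * m) / 4)))) := by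
        rw [show -(‖ζ‖ ^ (2 * m) / 2) = -(‖ζ‖ ^ (2 * m) / 4) + -(‖ζ‖ ^ (2 * m) / 4) by ring,
          Real.exp_add]
        ring
    _ ≤ Real.exp (2 * Real.pi * x * ζ.im) * ((2 * Real.pi) ^ n * C₁ *
        (C₂ * ((ε / (2 * Real.pi)) ^ n * M n) * (C₃ * (1 + M 2) * (1 + ζ.re ^ 2)⁻¹))) := by
        gcongr
    _ = _ := by
        rw [div_pow]
        field_simp

open MeasureTheory Filter Topology in
/-- Contour shift for entire functions with quadratic decay in horizontal strips. -/
theorem integral_horizontal_eq {H : ℂ → ℂ} (hH : Differentiable ℂ H) {R C : ℝ}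
    (hb : ∀ ζ : ℂ, |ζ.im| ≤ |R| → ‖H ζ‖ ≤ C * (1 + ζ.re ^ 2)⁻¹) :
    ∫ x : ℝ, H x = ∫ x : ℝ, H (x + R * Complex.I) := by
  have hint : ∀ y : ℝ, |y| ≤ |R| → Integrable fun x : ℝ => H (x + y * Complex.I) := by
    intro y hy
    refine (integrable_inv_one_add_sq.const_mul C).mono'
      (hH.continuous.comp (by fun_prop)).aestronglyMeasurable (ae_of_all _ fun x => ?_)
    have := hb (x + y * Complex.I) (by simpa using hy)
    simpa using this
  have hlim : ∀ y : ℝ, |y| ≤ |R| → Tendsto (fun T : ℝ => ∫ x in (-T)..T, H (x + y * Complex.I))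
      atTop (𝓝 (∫ x : ℝ, H (x + y * Complex.I))) := fun y hy =>
    intervalIntegral_tendsto_integral (hint y hy) tendsto_neg_atTop_atBot tendsto_id
  -- The vertical sides of the rectangle, at `T` and at `-T`, contribute `O(1 / T²)`.
  have hvert : ∀ s : ℝ, |s| = 1 → Tendsto (fun T : ℝ => ∫ y in (0 : ℝ)..R, H ((s * T : ℝ) + y * Complex.I))
      atTop (𝓝 0) := by
    intro s hs
    have hs2 : s ^ 2 = 1 := by rw [← sq_abs, hs, one_pow]
    have h1 : Tendsto (fun T : ℝ => C * (1 + T ^ 2)⁻¹ * |R - 0|) atTop (𝓝 0) := by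
      have h2 : Tendsto (fun T : ℝ => (1 + T ^ 2)⁻¹) atTop (𝓝 0) :=
        tendsto_inv_atTop_zero.comp
          (tendsto_atTop_add_const_left _ _ (tendsto_pow_atTop two_ne_zero))
      simpa using (h2.const_mul C).mul_const |R - 0|
    refine squeeze_zero_norm (fun T => ?_) h1
    refine intervalIntegral.norm_integral_le_of_norm_le_const fun y hy => ?_
    have hy' : |y| ≤ |R| := by
      rcases le_total 0 R with h | h
      · rw [Set.uIoc_of_le h] at hy
        rw [abs_of_pos hy.1, abs_of_nonneg h]
        exact hy.2
      · rw [Set.uIoc_of_ge h] at hy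
        rw [abs_of_nonpos hy.2, abs_of_nonpos h]
        linarith [hy.1]
    have := hb ((s * T : ℝ) + y * Complex.I) (by simpa using hy')
    simpa [mul_pow, hs2] using this
  have hrect : ∀ T : ℝ, (∫ x in (-T)..T, H (x + (0 : ℝ) * Complex.I)) -
      (∫ x in (-T)..T, H (x + R * Complex.I)) +
      Complex.I • (∫ y in (0 : ℝ)..R, H ((1 * T : ℝ) + y * Complex.I)) -
      Complex.I • (∫ y in (0 : ℝ)..R, H ((-1 * T : ℝ) + y * Complex.I)) = 0 := by
    intro T
    have := Complex.integral_boundary_rect_eq_zero_of_differentiableOn H (-T : ℝ)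
      ((T : ℝ) + R * Complex.I) hH.differentiableOn
    simpa using this
  have hall := (((hlim 0 (by simp)).sub (hlim R le_rfl)).add
    ((hvert 1 (by simp)).const_smul Complex.I)).sub ((hvert (-1) (by simp)).const_smul Complex.I)
  simp only [hrect, smul_zero, add_zero, sub_zero] at hall
  have := tendsto_nhds_unique hall tendsto_const_nhds
  simpa [sub_eq_zero] using this

end StripBounds

/-! ### The Fourier construction on the line. -/

section CutoffLine

open MeasureTheory FourierTransform

theorem inv_exp_abs_integrable : Integrable fun x : ℝ => Real.exp (-(2 * |x|)) := by
  refine integrable_inv_one_add_sq.mono' (by fun_prop) (ae_of_all _ fun x => ?_)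
  rw [Real.norm_of_nonneg (Real.exp_pos _).le, Real.exp_neg]
  refine inv_anti₀ (by positivity) ?_
  have h1 := Real.add_one_le_exp |x|
  rw [two_mul, Real.exp_add, ← sq_abs]
  nlinarith [abs_nonneg x]

/-- There is a function of integral one all of whose derivatives are bounded by `M` and decay
faster than any exponential. -/
theorem RegularityWeight.exists_integral_eq_one (M : RegularityWeight) : ∃ χ : ℝ → ℂ,
    ContDiff ℝ ∞ χ ∧ (∀ R ε : ℝ, 0 < R → 0 < ε → ∃ C : ℝ, 0 < C ∧ ∀ (n : ℕ) (x : ℝ),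
      ‖iteratedDeriv n χ x‖ ≤ C * (ε ^ n * M n) * Real.exp (-(R * |x|))) ∧
    Integrable χ ∧ ∫ x, χ x = 1 := by
  obtain ⟨m, hm, h⟩ := exists_norm_fourierIntegrand_le M
  have hpi := Real.pi_pos
  set f : ℝ → ℂ := fun ξ => Complex.exp (-(ξ : ℂ) ^ (2 * m)) with hf
  have hfc : Continuous f := by fun_prop
  have hint : ∀ n : ℕ, Integrable fun ξ : ℝ => ξ ^ n • f ξ := by
    intro n
    obtain ⟨C, hC, hb⟩ := h 0 1 one_pos
    refine (integrable_inv_one_add_sq.const_mul (C * M n)).mono'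
      (by fun_prop) (ae_of_all _ fun ξ => ?_)
    have h1 := hb n 0 ξ (by simp)
    simp only [fourierIntegrand, Complex.ofReal_zero, mul_zero, zero_mul, Complex.exp_zero, one_mul,
      one_pow, Real.exp_zero, mul_one, Complex.ofReal_re, norm_mul] at h1
    refine le_trans ?_ h1
    rw [norm_smul, norm_pow, norm_pow]
    simp only [hf]
    gcongr
    simp only [norm_mul, Complex.norm_real, norm_neg, Complex.norm_I, Complex.norm_ofNat, mul_one,
      Real.norm_of_nonneg hpi.le]
    exact le_mul_of_one_le_left (abs_nonneg _) (by linarith [Real.pi_gt_three])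
  have hfi : Integrable f := by simpa using hint 0
  have hder : ∀ (n : ℕ) (x : ℝ), iteratedDeriv n (𝓕 f) x = ∫ ξ : ℝ, fourierIntegrand m n x ξ := by
    intro n x
    rw [Real.iteratedDeriv_fourier (N := ⊤) (fun n _ => hint n) le_top,
      Real.fourier_real_eq_integral_exp_smul]
    congr 1
    ext ξ
    simp only [fourierIntegrand, hf, smul_eq_mul]
    congr 2
    push_cast
    ring
  have hbound : ∀ R ε : ℝ, 0 < R → 0 < ε → ∃ C : ℝ, 0 < C ∧ ∀ (n : ℕ) (x : ℝ),
      ‖iteratedDeriv n (𝓕 f) x‖ ≤ C * (ε ^ n * M n) * Real.exp (-(R * |x|)) := by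
    intro R ε hR hε
    obtain ⟨C, hC, hb⟩ := h (R / (2 * Real.pi)) ε hε
    refine ⟨C * Real.pi, by positivity, fun n x => ?_⟩
    have hMn := M.isWeight.pos n
    -- The contour moves to the side opposite to the sign of `x`, which turns the oscillating
    -- exponential into the decay `exp (-R|x|)`.
    obtain ⟨s, hs, hsx⟩ : ∃ s : ℝ, |s| = R / (2 * Real.pi) ∧ 2 * Real.pi * x * s = -(R * |x|) := by
      rcases le_total 0 x with hx | hx
      · refine ⟨-(R / (2 * Real.pi)), by rw [abs_neg, abs_of_pos (by positivity)], ?_⟩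
        rw [abs_of_nonneg hx]
        field_simp
      · refine ⟨R / (2 * Real.pi), abs_of_pos (by positivity), ?_⟩
        rw [abs_of_nonpos hx]
        field_simp
    have hshift : ∫ ξ : ℝ, fourierIntegrand m n x ξ =
        ∫ ξ : ℝ, fourierIntegrand m n x (ξ + s * Complex.I) := by
      refine integral_horizontal_eq (differentiable_fourierIntegrand m n x)
        (C := C * (ε ^ n * M n) * Real.exp (R * |x|)) fun ζ hζ => ?_
      rw [hs] at hζ
      refine (hb n x ζ hζ).trans (mul_le_mul_of_nonneg_right (mul_le_mul_of_nonneg_left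
        (Real.exp_le_exp.2 ?_) (by positivity)) (by positivity))
      refine (le_abs_self _).trans ?_
      rw [abs_mul, abs_mul, abs_of_pos (by positivity : 0 < 2 * Real.pi)]
      calc 2 * Real.pi * |x| * |ζ.im| ≤ 2 * Real.pi * |x| * (R / (2 * Real.pi)) := by gcongr
        _ = R * |x| := by field_simp
    rw [hder, hshift]
    calc _ ≤ ∫ ξ : ℝ, C * (ε ^ n * M n) * Real.exp (-(R * |x|)) * (1 + ξ ^ 2)⁻¹ := by
          refine norm_integral_le_of_norm_le (integrable_inv_one_add_sq.const_mul _)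
            (ae_of_all _ fun ξ => ?_)
          have := hb n x (ξ + s * Complex.I) (by simp [hs])
          simpa [hsx] using this
      _ = _ := by
          rw [integral_const_mul, integral_univ_inv_one_add_sq]
          ring
  have hsm : ContDiff ℝ ∞ (𝓕 f) := by
    refine Real.contDiff_fourier fun n _ => ?_
    simpa [norm_smul] using (hint n).norm
  have hχi : Integrable (𝓕 f) := by
    obtain ⟨C, hC, hb⟩ := hbound 2 1 two_pos one_pos
    refine (inv_exp_abs_integrable.const_mul C).mono' hsm.continuous.aestronglyMeasurable
      (ae_of_all _ fun x => ?_)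
    simpa [M.isWeight.zero] using hb 0 x
  refine ⟨𝓕 f, hsm, hbound, hχi, ?_⟩
  -- Fourier inversion at the origin: the integral of `𝓕 f` is `f 0 = 1`.
  have hinv := congrFun (hfc.fourierInv_fourier_eq hfi hχi) 0
  rw [Real.fourierInv_eq'] at hinv
  simpa [hf, hm.ne'] using hinv

theorem RegularityWeight.exists_partition_of_unity_line (M : RegularityWeight) : ∃ θ : ℝ → ℂ,
    ContDiff ℝ ∞ θ ∧ (∀ R ε : ℝ, 0 < R → 0 < ε → ∃ C : ℝ, 0 < C ∧ ∀ (n : ℕ) (x : ℝ),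
      ‖iteratedDeriv n θ x‖ ≤ C * (ε ^ n * M n) * Real.exp (-(R * |x|))) ∧
    ∀ y : ℝ, HasSum (fun k : ℤ => θ (y + k)) 1 := by
  obtain ⟨χ, hχ, hb, hi, h1⟩ := M.exists_integral_eq_one
  have hc := hχ.continuous
  -- The unit intervals `[y + k, y + k + 1]` tile the line, so the translates add up to `∫ χ = 1`.
  -- Derivatives of `θ` are differences of derivatives of `χ` of one order less; the factor `2 / ε`
  -- in the constant pays for the two terms and the shifted order.
  set θ : ℝ → ℂ := fun x => ∫ s in x..x + 1, χ s with hθ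
  have hderiv : ∀ x, HasDerivAt θ (χ (x + 1) - χ x) x := by
    intro x
    have h2 : ∀ y, HasDerivAt (fun u => ∫ s in (0 : ℝ)..u, χ s) (χ y) y := fun y =>
      intervalIntegral.integral_hasDerivAt_right (hc.intervalIntegrable _ _)
        (hc.stronglyMeasurableAtFilter _ _) hc.continuousAt
    have h3 := ((h2 (x + 1)).comp_add_const x 1).sub (h2 x)
    refine h3.congr_of_eventuallyEq (Filter.Eventually.of_forall fun u => ?_)
    exact (intervalIntegral.integral_interval_sub_left (hc.intervalIntegrable _ _)
      (hc.intervalIntegrable _ _)).symm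
  have hd : deriv θ = fun x => χ (x + 1) - χ x := funext fun x => (hderiv x).deriv
  have hχ1 : ContDiff ℝ ∞ fun x => χ (x + 1) := hχ.comp (contDiff_id.add contDiff_const)
  have hθs : ContDiff ℝ ∞ θ := by
    rw [contDiff_infty_iff_deriv, hd]
    exact ⟨fun x => (hderiv x).differentiableAt, hχ1.sub hχ⟩
  have hexp : ∀ R : ℝ, 0 < R → ∀ x s : ℝ, 0 ≤ s → s ≤ 1 →
      Real.exp (-(R * |x + s|)) ≤ Real.exp R * Real.exp (-(R * |x|)) := by
    intro R hR x s hs hs1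
    rw [← Real.exp_add, Real.exp_le_exp]
    have : |x| ≤ |x + s| + 1 := by
      calc |x| = |(x + s) - s| := by ring_nf
        _ ≤ |x + s| + |s| := abs_sub _ _
        _ ≤ _ := by
            rw [abs_of_nonneg hs]
            linarith
    nlinarith
  refine ⟨θ, hθs, fun R ε hR hε => ?_, fun y => ?_⟩
  · obtain ⟨C, hC, hCb⟩ := hb R ε hR hε
    have hE := Real.exp_pos R
    refine ⟨C * Real.exp R * (1 + 2 / ε), by positivity, fun n x => ?_⟩
    have hEx := Real.exp_pos (-(R * |x|))
    rcases n with _ | n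
    · simp only [iteratedDeriv_zero, pow_zero, M.isWeight.zero, mul_one]
      have h2 : ‖θ x‖ ≤ C * (Real.exp R * Real.exp (-(R * |x|))) * |x + 1 - x| := by
        refine intervalIntegral.norm_integral_le_of_norm_le_const fun s hs => ?_
        rw [Set.uIoc_of_le (by linarith)] at hs
        have h3 := hCb 0 s
        simp only [iteratedDeriv_zero, pow_zero, M.isWeight.zero, mul_one] at h3
        refine h3.trans ?_
        have h4 := hexp R hR x (s - x) (by linarith [hs.1]) (by linarith [hs.2])
        rw [add_sub_cancel] at h4
        gcongr
      refine h2.trans ?_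
      rw [add_sub_cancel_left, abs_one, mul_one, ← mul_assoc]
      refine mul_le_mul_of_nonneg_right (le_mul_of_one_le_right (by positivity) ?_) hEx.le
      linarith [show 0 < 2 / ε by positivity]
    · have hMn := M.isWeight.pos n
      have hMn1 := M.isWeight.pos (n + 1)
      have hMm : M n ≤ M (n + 1) := M.isWeight.monotone (Nat.le_succ n)
      rw [iteratedDeriv_succ', hd, iteratedDeriv_fun_sub (hχ1.contDiffAt.of_le (mod_cast le_top))
        (hχ.contDiffAt.of_le (mod_cast le_top)), iteratedDeriv_comp_add_const]
      have h2 := (hCb n (x + 1)).trans (mul_le_mul_of_nonneg_left (hexp R hR x 1 zero_le_one le_rfl)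
        (by positivity))
      have h3 := (hCb n x).trans (mul_le_mul_of_nonneg_left (le_mul_of_one_le_left hEx.le
        (Real.one_le_exp hR.le)) (by positivity))
      refine (norm_sub_le _ _).trans ((add_le_add h2 h3).trans ?_)
      calc _ = C * Real.exp R * (2 / ε) * (ε ^ (n + 1) * M n) * Real.exp (-(R * |x|)) := by
            rw [pow_succ]
            field_simp
            ring
        _ ≤ _ := by
            gcongr
            linarith
  · have := hi.hasSum_intervalIntegral y
    rwa [h1] at this

end CutoffLine

/-! ### A partition of unity indexed by the integer lattice -/

section Lattice

theorem HasSum.mul_of_summable_norm {𝕜 : Type*} [NormedField 𝕜] [CompleteSpace 𝕜] {ι κ : Type*}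
    {f : ι → 𝕜} {g : κ → 𝕜} {a b : 𝕜} (hf : HasSum f a) (hg : HasSum g b)
    (hf' : Summable fun i => ‖f i‖) (hg' : Summable fun k => ‖g k‖) :
    HasSum (fun p : ι × κ => f p.1 * g p.2) (a * b) := by
  have h := (hf'.mul_norm hg').of_norm
  exact hf.mul hg h

theorem hasSum_prod_pi {𝕜 : Type*} [NormedField 𝕜] [CompleteSpace 𝕜] {d : ℕ} {f : Fin d → ℤ → 𝕜}
    {a : Fin d → 𝕜} (hs : ∀ j, Summable fun k => ‖f j k‖) (h : ∀ j, HasSum (f j) (a j)) :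
    (Summable fun k : Fin d → ℤ => ‖∏ j, f j (k j)‖) ∧
      HasSum (fun k : Fin d → ℤ => ∏ j, f j (k j)) (∏ j, a j) := by
  induction d with
  | zero =>
    refine ⟨Summable.of_finite, ?_⟩
    simp
  | succ d ih =>
    obtain ⟨ih1, ih2⟩ := ih (fun j => hs j.succ) fun j => h j.succ
    have h1 : ∀ p : ℤ × (Fin d → ℤ), ∏ j, f j (Fin.consEquiv (fun _ : Fin (d + 1) => ℤ) p j) =
        f 0 p.1 * ∏ j : Fin d, f j.succ (p.2 j) := by
      intro p
      rw [Fin.prod_univ_succ]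
      rfl
    have h2 := (hs 0).mul_norm ih1
    constructor
    · rw [← (Fin.consEquiv (fun _ : Fin (d + 1) => ℤ)).summable_iff]
      exact h2.congr fun p => by rw [Function.comp_apply, h1]
    · rw [← (Fin.consEquiv (fun _ : Fin (d + 1) => ℤ)).hasSum_iff, Fin.prod_univ_succ]
      have h3 := HasSum.mul_of_summable_norm (h 0) ih2 (hs 0) ih1
      rwa [← show _ = _ from funext h1] at h3

variable {d : ℕ}

/-- The point of the integer lattice with coordinates `k`. -/
noncomputable def latticePoint (k : Fin d → ℤ) : EuclideanSpace ℝ (Fin d) :=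
  WithLp.toLp 2 fun j => (k j : ℝ)

@[simp] theorem latticePoint_apply (k : Fin d → ℤ) (j : Fin d) : latticePoint k j = k j := rfl

theorem summable_int_inv_one_add_sq : Summable fun k : ℤ => (1 + (k : ℝ) ^ 2)⁻¹ := by
  refine Summable.of_norm_bounded_eventually (Real.summable_one_div_int_pow.2 one_lt_two) ?_
  -- The comparison with `1 / k²` fails at `k = 0`, where the quotient has the default value 0.
  have : {k : ℤ | k = 0}.Finite := by simp
  filter_upwards [this.compl_mem_cofinite] with k hk
  have hk0 : (0 : ℝ) < (k : ℝ) ^ 2 := by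
    have : k ≠ 0 := hk
    positivity
  rw [Real.norm_of_nonneg (by positivity), one_div]
  exact inv_anti₀ hk0 (by linarith)

theorem summable_inv_one_add_norm_latticePoint_pow (d : ℕ) :
    Summable fun k : Fin d → ℤ => 1 / (1 + ‖latticePoint k‖) ^ (2 * d) := by
  have h1 := (hasSum_prod_pi (d := d) (f := fun _ (k : ℤ) => (1 + (k : ℝ) ^ 2)⁻¹)
    (fun _ => summable_int_inv_one_add_sq.norm) fun _ => summable_int_inv_one_add_sq.hasSum).1
  refine h1.of_nonneg_of_le (fun k => by positivity) fun k => ?_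
  rw [Real.norm_of_nonneg (Finset.prod_nonneg fun j _ => by positivity), Finset.prod_inv_distrib,
    one_div]
  refine inv_anti₀ (Finset.prod_pos fun j _ => by positivity) ?_
  calc ∏ j, (1 + (k j : ℝ) ^ 2) ≤ ∏ _j : Fin d, (1 + ‖latticePoint k‖) ^ 2 := by
        refine Finset.prod_le_prod (fun j _ => by positivity) fun j _ => ?_
        have h2 := PiLp.norm_apply_le (latticePoint k) j
        rw [latticePoint_apply, Real.norm_eq_abs] at h2
        have h3 := pow_le_pow_left₀ (abs_nonneg _) h2 2
        rw [sq_abs] at h3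
        nlinarith [norm_nonneg (latticePoint k)]
    _ = _ := by rw [Finset.prod_const, Finset.card_univ, Fintype.card_fin, ← pow_mul]

theorem EuclideanSpace.norm_le_sum_abs (x : EuclideanSpace ℝ (Fin d)) : ‖x‖ ≤ ∑ j, |x j| := by
  have hx : x = ∑ j, EuclideanSpace.single j (x j) := by
    ext i
    simp [Pi.single_apply]
  conv_lhs => rw [hx]
  exact (norm_sum_le _ _).trans (Finset.sum_le_sum fun j _ => by simp)

/-- Each letter `j` differentiates `θ` once and any other letter annihilates the function, so the
constant arises as a product of zeros and ones. -/
theorem exists_wordD_comp_apply {θ : ℝ → ℂ} (hθ : ContDiff ℝ ∞ θ) (j : Fin d)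
    (w : List (Fin d)) : ∃ c : ℂ, ‖c‖ ≤ 1 ∧
      wordD w (fun x : EuclideanSpace ℝ (Fin d) => θ (x j)) =
        fun x => c * iteratedDeriv w.length θ (x j) := by
  induction w with
  | nil => exact ⟨1, by simp, by simp⟩
  | cons i w ih =>
    obtain ⟨c, hc, hw⟩ := ih
    refine ⟨c * if j = i then 1 else 0, ?_, ?_⟩
    · rw [norm_mul]
      split_ifs <;> simp [hc]
    · ext x
      rw [wordD_cons, hw, partialD, List.length_cons, iteratedDeriv_succ]
      have h1 : HasDerivAt (iteratedDeriv w.length θ)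
          (deriv (iteratedDeriv w.length θ) (x j)) (x j) :=
        (hθ.differentiable_iteratedDeriv w.length (mod_cast ENat.natCast_lt_top _) _).hasDerivAt
      have h2 := (h1.hasFDerivAt.comp x
        (EuclideanSpace.proj (𝕜 := ℝ) (ι := Fin d) j).hasFDerivAt).const_mul c
      have h3 : fderiv ℝ (fun x : EuclideanSpace ℝ (Fin d) =>
          c * iteratedDeriv w.length θ (x j)) x = _ := h2.fderiv
      rw [h3]
      simp

theorem RegularityWeight.exists_partition_of_unity (M : RegularityWeight) (d : ℕ) :
    ∃ θ : EuclideanSpace ℝ (Fin d) → ℂ, ContDiff ℝ ∞ θ ∧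
      (∀ R ε : ℝ, 0 < R → 0 < ε → ∃ C : ℝ, 0 < C ∧ ∀ w x,
        ‖wordD w θ x‖ ≤ C * Real.exp (-(R * ‖x‖)) * (ε ^ w.length * M w.length)) ∧
      ∀ y, HasSum (fun k : Fin d → ℤ => θ (latticePoint k - y)) 1 := by
  obtain ⟨θ, hθ, hb, hsum⟩ := M.exists_partition_of_unity_line
  have hsm : ∀ j : Fin d, ContDiff ℝ ∞ fun x : EuclideanSpace ℝ (Fin d) => θ (x j) := fun j =>
    hθ.comp (EuclideanSpace.proj (𝕜 := ℝ) (ι := Fin d) j).contDiff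
  refine ⟨∏ j, fun x => θ (x j), ?_, fun R ε hR hε => ?_, fun y => ?_⟩
  · rw [Finset.prod_fn]
    exact contDiff_prod fun j _ => hsm j
  -- The scales of the `d` factors add up to at most `ε`; dividing by `d + 1` also covers `d = 0`.
  · obtain ⟨C, hC, hCb⟩ := hb R (ε / (d + 1)) hR (by positivity)
    refine ⟨C ^ d, by positivity, fun w x => ?_⟩
    have hM := M.isWeight.pos w.length
    have h1 := norm_wordD_prod_le M.isWeight Finset.univ hsm (x := x)
      (U := fun j => C * Real.exp (-(R * |x j|))) (a := ε / (d + 1)) (fun j => by positivity)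
      (by positivity) (fun j w => by
        obtain ⟨c, hc, hw⟩ := exists_wordD_comp_apply hθ j w
        rw [hw, norm_mul]
        refine (mul_le_of_le_one_left (norm_nonneg _) hc).trans ((hCb _ _).trans (le_of_eq ?_))
        ring) w
    refine h1.trans ?_
    rw [Finset.prod_mul_distrib, Finset.prod_const, ← Real.exp_sum, Finset.card_univ,
      Fintype.card_fin]
    have h2 : (d : ℝ) * (ε / (d + 1)) ≤ ε := by
      rw [mul_div_assoc', div_le_iff₀ (by positivity)]
      nlinarith
    have h3 : ∑ j, -(R * |x j|) ≤ -(R * ‖x‖) := by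
      rw [Finset.sum_neg_distrib, ← Finset.mul_sum]
      exact neg_le_neg (mul_le_mul_of_nonneg_left (EuclideanSpace.norm_le_sum_abs x) hR.le)
    gcongr
  · have h1 := (hasSum_prod_pi (d := d) (f := fun j (k : ℤ) => θ (-y j + k))
      (fun j => (hsum (-y j)).summable.norm) fun j => hsum (-y j)).2
    rw [Finset.prod_const_one] at h1
    refine h1.congr_fun fun k => ?_
    simp [sub_eq_neg_add]

end Lattice

/-! ### Localization estimates -/

section Localization

variable {d : ℕ} {M : RegularityWeight} {A : DecayWeight}

theorem gsTerm_le_gsTerm {h h' : ℝ} (hh : 0 < h) (hle : h ≤ h')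
    (φ : EuclideanSpace ℝ (Fin d) → ℂ) (i) : gsTerm M A h φ i ≤ gsTerm M A h' φ i := by
  have hM := M.isWeight.pos (∑ j, i.1 j)
  have hh' : 0 < h' := hh.trans_le hle
  have := A.associatedFunction_mono (ρ := h * ‖i.2‖) (ρ' := h' * ‖i.2‖) (by positivity)
    (by gcongr)
  unfold gsTerm
  gcongr

theorem gsTerm_reflect_le {h S : ℝ} (hh : 0 < h) {φ : EuclideanSpace ℝ (Fin d) → ℂ}
    (hφ : ContDiff ℝ ∞ φ) (hS : ∀ i, gsTerm M A (2 * h) φ i ≤ S) (x : EuclideanSpace ℝ (Fin d)) (i) :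
    gsTerm M A h (fun y => φ (x - y)) i ≤ A.expAssoc (2 * h * ‖x‖) * S := by
  have hS0 : 0 ≤ S := (gsTerm_nonneg M A (by positivity) φ (0, 0)).trans (hS _)
  refine gsTerm_le_of_norm_wordD_le hh (fun w y => ?_) i
  rw [norm_wordD_reflect hφ]
  refine (norm_wordD_le_of_gsTerm_le (by positivity) hφ hS w (x - y)).trans ?_
  have hM := M.isWeight.pos w.length
  have h1 := A.expAssoc_le_mul (a := h * ‖y‖) (b := h * ‖x‖) (c := h * ‖x - y‖) (by positivity) (by
    rw [← mul_add]
    gcongr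
    calc ‖y‖ = ‖x - (x - y)‖ := by simp
      _ ≤ _ := norm_sub_le _ _)
  rw [← mul_assoc, ← mul_assoc] at h1
  have hE1 := A.expAssoc_pos (h * ‖y‖)
  have hE2 := A.expAssoc_pos (2 * h * ‖x‖)
  have hE3 := A.expAssoc_pos (2 * h * ‖x - y‖)
  have h2 : (A.expAssoc (2 * h * ‖x - y‖))⁻¹ ≤ A.expAssoc (2 * h * ‖x‖) * (A.expAssoc (h * ‖y‖))⁻¹ := by
    rw [← div_eq_mul_inv, le_div_iff₀ hE1, inv_mul_le_iff₀ hE3]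
    linarith
  have h3 : (2 * h)⁻¹ ≤ h⁻¹ := inv_anti₀ hh (by linarith)
  calc _ ≤ S * (A.expAssoc (2 * h * ‖x‖) * (A.expAssoc (h * ‖y‖))⁻¹) *
        (h⁻¹ ^ w.length * M w.length) := by gcongr
    _ = _ := by ring

/-- The function `z ↦ ψ (y - z) θ z`. -/
def localize (θ : EuclideanSpace ℝ (Fin d) → ℂ) (y : EuclideanSpace ℝ (Fin d))
    (ψ : EuclideanSpace ℝ (Fin d) → ℂ) : EuclideanSpace ℝ (Fin d) → ℂ :=
  fun z => ψ (y - z) * θ z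

/-- Smooth functions with `M`-bounded derivatives, all decaying faster than any exponential. -/
structure IsLocalizer (M : RegularityWeight) (θ : EuclideanSpace ℝ (Fin d) → ℂ) : Prop where
  contDiff : ContDiff ℝ ∞ θ
  bound : ∀ R ε : ℝ, 0 < R → 0 < ε → ∃ C : ℝ, 0 < C ∧ ∀ w x,
    ‖wordD w θ x‖ ≤ C * Real.exp (-(R * ‖x‖)) * (ε ^ w.length * M w.length)

variable {θ : EuclideanSpace ℝ (Fin d) → ℂ}

theorem IsLocalizer.contDiff_localize (hθ : IsLocalizer M θ) {ψ : EuclideanSpace ℝ (Fin d) → ℂ}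
    (hψ : ContDiff ℝ ∞ ψ) (y : EuclideanSpace ℝ (Fin d)) : ContDiff ℝ ∞ (localize θ y ψ) :=
  (hψ.comp (contDiff_const.sub contDiff_id)).mul hθ.contDiff

/-- The point `y` is far from the origin only if `y - z` or `z` is: `exp A(k|y|/2)` is at most `exp
A(k|y-z|) exp A(k|z|)`. The first factor is paid by the decay of `ψ`. The second is at most
exponential in `|z|`, and the rate `Lk + k/2` of `θ` pays for it together with the weight for `p!`.
The Leibniz rule adds the scales, `1/k + 1/k = 1/(k/2)`. -/
theorem IsLocalizer.exists_gsTerm_localize_le (hθ : IsLocalizer M θ) (A : DecayWeight) {k : ℝ}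
    (hk : 0 < k) : ∃ C : ℝ, 0 < C ∧ ∀ (ψ : EuclideanSpace ℝ (Fin d) → ℂ) (S : ℝ),
      ContDiff ℝ ∞ ψ → (∀ i, gsTerm M A k ψ i ≤ S) → ∀ y i,
        gsTerm M factorialWeight (k / 2) (localize θ y ψ) i ≤
          C * S * (A.expAssoc (k / 2 * ‖y‖))⁻¹ := by
  obtain ⟨K, L, hK, hL, hKL⟩ := A.exists_expAssoc_le_exp
  obtain ⟨C, hC, hb⟩ := hθ.bound (L * k + k / 2) k⁻¹ (by positivity) (by positivity)
  refine ⟨C * K, by positivity, fun ψ S hψ hS y i => ?_⟩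
  have hS0 : 0 ≤ S := (gsTerm_nonneg M A hk ψ (0, 0)).trans (hS _)
  refine gsTerm_le_of_norm_wordD_le (by positivity) (fun w z => ?_) i
  have hM := M.isWeight.pos w.length
  have hE1 := A.expAssoc_pos (k * ‖y - z‖)
  have hE2 := A.expAssoc_pos (k / 2 * ‖y‖)
  have hE3 := A.expAssoc_pos (k * ‖z‖)
  have hE4 := factorialWeight.expAssoc_pos (k / 2 * ‖z‖)
  have hψ' : ContDiff ℝ ∞ fun z => ψ (y - z) := hψ.comp (contDiff_const.sub contDiff_id)
  have h1 := norm_wordD_mul_le M.isWeight hψ' hθ.contDiff (x := z)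
    (U := S * (A.expAssoc (k * ‖y - z‖))⁻¹) (V := C * Real.exp (-((L * k + k / 2) * ‖z‖)))
    (a := k⁻¹) (b := k⁻¹) (by positivity) (by positivity) (by positivity) (by positivity)
    (fun w => by
      rw [norm_wordD_reflect hψ]
      exact norm_wordD_le_of_gsTerm_le hk hψ hS w (y - z)) (fun w => hb w z) w
  have h2 : k⁻¹ + k⁻¹ = (k / 2)⁻¹ := by
    field_simp
    norm_num
  rw [h2] at h1
  refine h1.trans (mul_le_mul_of_nonneg_right ?_ (by positivity))
  have h3 : A.expAssoc (k / 2 * ‖y‖) ≤ A.expAssoc (k * ‖y - z‖) * A.expAssoc (k * ‖z‖) := by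
    have := A.expAssoc_le_mul (a := k / 2 * ‖y‖) (b := k / 2 * ‖y - z‖) (c := k / 2 * ‖z‖)
      (by positivity) (by
        rw [← mul_add]
        gcongr
        calc ‖y‖ = ‖(y - z) + z‖ := by simp
          _ ≤ _ := norm_add_le _ _)
    convert this using 3 <;> ring
  have h4 := hKL (k * ‖z‖) (by positivity)
  have h5 := DecayWeight.expAssoc_factorialWeight_le (show 0 ≤ k / 2 * ‖z‖ by positivity)
  have h6 : Real.exp (-((L * k + k / 2) * ‖z‖)) * Real.exp (L * (k * ‖z‖)) *
      Real.exp (k / 2 * ‖z‖) = 1 := by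
    rw [← Real.exp_add, ← Real.exp_add, ← Real.exp_zero]
    congr 1
    ring
  rw [← div_eq_mul_inv, ← div_eq_mul_inv, ← div_eq_mul_inv, div_mul_eq_mul_div, div_div,
    div_le_div_iff₀ hE1 (by positivity)]
  set e := Real.exp (-((L * k + k / 2) * ‖z‖))
  have he : 0 < e := Real.exp_pos _
  calc S * (C * e) * (A.expAssoc (k / 2 * ‖y‖) * factorialWeight.expAssoc (k / 2 * ‖z‖))
      ≤ S * (C * e) * ((A.expAssoc (k * ‖y - z‖) * (K * Real.exp (L * (k * ‖z‖)))) *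
        Real.exp (k / 2 * ‖z‖)) := by
        gcongr
        exact h3.trans (by gcongr)
    _ = C * K * S * A.expAssoc (k * ‖y - z‖) *
        (e * Real.exp (L * (k * ‖z‖)) * Real.exp (k / 2 * ‖z‖)) := by ring
    _ = _ := by rw [h6, mul_one]

theorem IsLocalizer.localize_mem (hθ : IsLocalizer M θ) {k k' : {h : ℝ // 0 < h}}
    (hk : (k : ℝ) = 2 * k') {ψ : EuclideanSpace ℝ (Fin d) → ℂ} (hψ : ψ ∈ gsStepSubmodule d M A k)
    (y : EuclideanSpace ℝ (Fin d)) : localize θ y ψ ∈ gsStepSubmodule d M factorialWeight k' := by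
  obtain ⟨C, hC, h⟩ := hθ.exists_gsTerm_localize_le A k.2
  obtain ⟨hψs, S, hS⟩ := hψ
  refine ⟨hθ.contDiff_localize hψs y, C * S * (A.expAssoc (k' * ‖y‖))⁻¹, ?_⟩
  rintro _ ⟨i, rfl⟩
  have := h ψ S hψs (fun i => hS ⟨i, rfl⟩) y i
  rwa [hk, mul_div_cancel_left₀ _ two_ne_zero] at this

/-- The localizations of a test function at the lattice points sum up to that function. -/
theorem IsLocalizer.hasSum_localize (hθ : IsLocalizer M θ)
    (hsum : ∀ y, HasSum (fun n : Fin d → ℤ => θ (latticePoint n - y)) 1) :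
    ∃ H : ℝ, 1 ≤ H ∧ ∀ (h : {h : ℝ // 0 < h}) (ψ : GSStep d M factorialWeight h)
      (s : (Fin d → ℤ) → GSStep d M factorialWeight h),
      BddAbove (Set.range (gsTerm M factorialWeight (4 * H * h) ψ.1)) →
      (∀ n w, (s n).1 w = localize θ (latticePoint n) ψ.1 (latticePoint n - w)) →
      HasSum s ψ := by
  obtain ⟨H, hH, hH'⟩ := factorialWeight.exists_expAssoc_div_le
  refine ⟨H, hH, fun h ψ s ⟨S, hS⟩ hs => ?_⟩
  have hh : (0 : ℝ) < h := h.2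
  -- Localization and reflection each halve the scale, and a further factor `H` makes the quotient
  -- of weights at the lattice points summable.
  have hk : 0 < 4 * H * h := by positivity
  obtain ⟨C, hC, hCb⟩ := hθ.exists_gsTerm_localize_le factorialWeight hk
  obtain ⟨C', hC', hCb'⟩ := hH' (2 * d) (2 * h) (by positivity)
  have hS' : ∀ i, gsTerm M factorialWeight (4 * H * h) ψ.1 i ≤ S := fun i => hS ⟨i, rfl⟩
  have hS0 : 0 ≤ S := (gsTerm_nonneg M factorialWeight hk ψ.1 (0, 0)).trans (hS' _)
  have hnorm : ∀ n, ‖s n‖ ≤ C * S * C' * (1 / (1 + ‖latticePoint n‖) ^ (2 * d)) := by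
    intro n
    refine GSStep.norm_le _ fun i => ?_
    have h1 : (s n).1 = fun w => localize θ (latticePoint n) ψ.1 (latticePoint n - w) :=
      funext (hs n)
    rw [h1]
    have h2 := gsTerm_reflect_le (A := factorialWeight) hh
      (hθ.contDiff_localize ψ.2.1 (latticePoint n)) (fun i =>
        (gsTerm_le_gsTerm (by positivity) (by nlinarith : 2 * (h : ℝ) ≤ 4 * H * h / 2) _ i).trans
          (hCb ψ.1 S ψ.2.1 hS' (latticePoint n) i)) (latticePoint n) i
    have h3 := hCb' ‖latticePoint n‖ (norm_nonneg _)
    refine h2.trans ?_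
    rw [show 4 * H * h / 2 = H * (2 * (h : ℝ)) by ring]
    calc _ = C * S * (factorialWeight.expAssoc (2 * h * ‖latticePoint n‖) /
          factorialWeight.expAssoc (H * (2 * h) * ‖latticePoint n‖)) := by ring
      _ ≤ C * S * (C' / (1 + ‖latticePoint n‖) ^ (2 * d)) := by gcongr
      _ = _ := by ring
  have hsm : Summable s := Summable.of_norm_bounded
    ((summable_inv_one_add_norm_latticePoint_pow d).mul_left _) hnorm
  -- Absolute convergence in the Banach space gives some sum; point evaluations identify it with
  -- `ψ`.
  obtain ⟨a, ha⟩ := hsm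
  suffices hψ : a = ψ by rwa [← hψ]
  refine Subtype.ext (funext fun w => ?_)
  have h1 := (GSStep.evalCLM w).hasSum ha
  have h2 : HasSum (fun n : Fin d → ℤ => ψ.1 w * θ (latticePoint n - w)) (ψ.1 w * 1) :=
    (hsum w).mul_left _
  have h3 : (fun n => GSStep.evalCLM w (s n)) =
      fun n : Fin d → ℤ => ψ.1 w * θ (latticePoint n - w) := by
    ext n
    change (s n).1 w = _
    rw [hs, localize, sub_sub_cancel]
  rw [h3] at h1
  have h4 := h1.unique h2
  rw [mul_one] at h4
  exact h4

end Localization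

/-- The sum of a pointwise summable family of linear functionals. -/
noncomputable def tsumLinearMap {ι V : Type*} [AddCommGroup V] [Module ℂ V] (l : ι → V →ₗ[ℂ] ℂ)
    (h : ∀ v, Summable fun i => l i v) : V →ₗ[ℂ] ℂ where
  toFun v := ∑' i, l i v
  map_add' v w := by
    simp only [map_add]
    exact (h v).tsum_add (h w)
  map_smul' c v := by
    simp only [map_smul, smul_eq_mul, RingHom.id_apply]
    exact tsum_mul_left

theorem norm_tsumLinearMap_le {ι V : Type*} [AddCommGroup V] [Module ℂ V] {l : ι → V →ₗ[ℂ] ℂ}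
    (h : ∀ v, Summable fun i => l i v) {c : ι → ℝ} (hc : Summable c) {v : V} {K : ℝ}
    (hb : ∀ i, ‖l i v‖ ≤ K * c i) : ‖tsumLinearMap l h v‖ ≤ (∑' i, c i) * K := by
  rw [mul_comm, ← tsum_mul_left]
  exact tsum_of_norm_bounded (hc.mul_left K).hasSum hb

/-! ### The Beurling case -/

section StepMaps

variable {d : ℕ} {M : RegularityWeight} {A : DecayWeight}

theorem GSStep.gsTerm_reflect_le {h h' : {h : ℝ // 0 < h}} (hh : (h' : ℝ) = 2 * h)
    (φ : GSStep d M A h') (x : EuclideanSpace ℝ (Fin d)) (i) :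
    gsTerm M A h (fun y => φ.1 (x - y)) i ≤ A.expAssoc (h' * ‖x‖) * ‖φ‖ := by
  have h1 := φ.gsTerm_le_norm
  rw [hh] at h1 ⊢
  exact _root_.gsTerm_reflect_le h.2 φ.2.1 h1 x i

/-- The inclusion of a smaller step into a larger one. -/
noncomputable def GSStep.inclusionCLM {h h' : {h : ℝ // 0 < h}} (hle : h ≤ h') :
    GSStep d M A h' →L[ℂ] GSStep d M A h :=
  LinearMap.mkContinuous
    { toFun := fun φ => GSStep.mk φ.1 (gsStepSubmodule_anti M A hle φ.2)
      map_add' := fun _ _ => rfl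
      map_smul' := fun _ _ => rfl } 1 fun φ => by
    rw [one_mul]
    exact GSStep.norm_le _ fun i => (gsTerm_le_gsTerm h.2 hle φ.1 i).trans (φ.gsTerm_le_norm i)

end StepMaps

namespace GSBeurling

variable {d : ℕ} {M : RegularityWeight} {A : DecayWeight}

theorem norm_toStep_mono {h h' : {h : ℝ // 0 < h}} (hle : h ≤ h') (φ : GSBeurling d M A) :
    ‖toStep h φ‖ ≤ ‖toStep h' φ‖ :=
  GSStep.norm_le _ fun i => (gsTerm_le_gsTerm h.2 hle φ.1 i).trans
    ((toStep h' φ).gsTerm_le_norm i)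

theorem tendsto_nhds_iff {ι : Type*} {l : Filter ι} {u : ι → GSBeurling d M A}
    {φ : GSBeurling d M A} : Filter.Tendsto u l (nhds φ) ↔
      ∀ h, Filter.Tendsto (fun i => toStep h (u i)) l (nhds (toStep h φ)) := by
  rw [nhds_iInf, Filter.tendsto_iInf]
  refine forall_congr' fun h => ?_
  rw [nhds_induced, Filter.tendsto_comap_iff]
  rfl

theorem continuous_toStep (h : {h : ℝ // 0 < h}) :
    Continuous (toStep (d := d) (M := M) (A := A) h) :=
  continuous_iInf_dom continuous_induced_dom

/-- The step `n + 1`. -/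
def natStep (n : ℕ) : {h : ℝ // 0 < h} := ⟨n + 1, by positivity⟩

theorem natStep_mono : Monotone natStep := fun m n h => by
  have : (m : ℝ) ≤ n := by exact_mod_cast h
  exact Subtype.mk_le_mk.2 (by linarith)

theorem exists_le_natStep (h : {h : ℝ // 0 < h}) : ∃ n, h ≤ natStep n := by
  obtain ⟨n, hn⟩ := exists_nat_ge (h : ℝ)
  exact ⟨n, Subtype.coe_le_coe.1 (show (h : ℝ) ≤ n + 1 by linarith)⟩

/-- The seminorms `σ_{n + 1}` on the Beurling space. -/
noncomputable def stepSeminorms (d : ℕ) (M : RegularityWeight) (A : DecayWeight) :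
    SeminormFamily ℂ (GSBeurling d M A) ((_ : ℕ) × Fin 1) :=
  SeminormFamily.sigma fun n : ℕ => SeminormFamily.comp
    (fun _ : Fin 1 => normSeminorm ℂ (GSStep d M A (natStep n))) (toStep (natStep n))

/-- Integer steps are cofinal, so countably many norms define the topology; this leads to
metrizability and the Baire property. -/
theorem topology_eq : (inferInstance : TopologicalSpace (GSBeurling d M A)) =
    ⨅ n : ℕ, TopologicalSpace.induced (toStep (natStep n)) inferInstance := by
  refine le_antisymm (le_iInf fun n => iInf_le _ _) (le_iInf fun h => ?_)
  obtain ⟨n, hn⟩ := exists_le_natStep h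
  refine (iInf_le _ n).trans ?_
  rw [← continuous_iff_le_induced]
  let _ : TopologicalSpace (GSBeurling d M A) :=
    TopologicalSpace.induced (toStep (natStep n)) inferInstance
  exact (GSStep.inclusionCLM hn).continuous.comp
    (continuous_induced_dom (f := toStep (d := d) (M := M) (A := A) (natStep n)))

theorem withSeminorms : WithSeminorms (stepSeminorms d M A) := by
  have h := withSeminorms_iInf
    (p := fun n : ℕ => SeminormFamily.comp
      (fun _ : Fin 1 => normSeminorm ℂ (GSStep d M A (natStep n))) (toStep (natStep n)))
    (t := fun n => TopologicalSpace.induced (toStep (natStep n)) inferInstance) fun n => LinearMap.withSeminorms_induced (norm_withSeminorms ℂ (GSStep d M A (natStep n)))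
      (toStep (natStep n))
  have h' := topology_eq (d := d) (M := M) (A := A)
  rw [← h'] at h
  exact h

instance : IsTopologicalAddGroup (GSBeurling d M A) := withSeminorms.topologicalAddGroup

instance : ContinuousSMul ℂ (GSBeurling d M A) := withSeminorms.continuousSMul

/-- A complete space with countably generated uniformity. A Cauchy sequence converges in every step,
and the limits are the same function since step convergence implies pointwise convergence. -/
instance : BaireSpace (GSBeurling d M A) := by
  let _ : UniformSpace (GSBeurling d M A) := IsTopologicalAddGroup.rightUniformSpace _
  have : IsUniformAddGroup (GSBeurling d M A) := isUniformAddGroup_of_addCommGroup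
  have : (nhds (0 : GSBeurling d M A)).IsCountablyGenerated := by
    rw [(SeminormFamily.withSeminorms_iff_nhds_eq_iInf _).1 (withSeminorms (d := d))]
    infer_instance
  have : (uniformity (GSBeurling d M A)).IsCountablyGenerated :=
    IsUniformAddGroup.uniformity_countably_generated
  have : CompleteSpace (GSBeurling d M A) := by
    refine UniformSpace.complete_of_cauchySeq_tendsto fun u hu => ?_
    have hstep : ∀ h, ∃ ψ : GSStep d M A h,
        Filter.Tendsto (fun n => toStep h (u n)) Filter.atTop (nhds ψ) := fun h =>
      cauchySeq_tendsto_of_complete ((uniformContinuous_addMonoidHom_of_continuous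
        (f := (toStep h).toAddMonoidHom) (continuous_toStep h)).comp_cauchySeq hu)
    choose ψ hψ using hstep
    have hpt : ∀ h x, Filter.Tendsto (fun n => (u n).1 x) Filter.atTop (nhds ((ψ h).1 x)) :=
      fun h x => ((GSStep.evalCLM x).continuous.tendsto (ψ h)).comp (hψ h)
    have heq : ∀ h, (ψ (natStep 0)).1 = (ψ h).1 := fun h =>
      funext fun x => tendsto_nhds_unique (hpt _ x) (hpt h x)
    refine ⟨⟨(ψ (natStep 0)).1, (Submodule.mem_iInf _).2 fun h => by
      rw [heq h]
      exact (ψ h).2⟩, tendsto_nhds_iff.2 fun h => ?_⟩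
    convert hψ h using 2
    exact Subtype.ext (heq h)
  infer_instance

/-- Continuity bounds `q` by a maximum of finitely many step norms; these increase with the step, so
the largest one suffices. -/
theorem exists_le_norm_toStep {q : Seminorm ℂ (GSBeurling d M A)} (hq : Continuous q) :
    ∃ (h : {h : ℝ // 0 < h}) (C : ℝ), 0 < C ∧ ∀ φ, q φ ≤ C * ‖toStep h φ‖ := by
  obtain ⟨s, C, hC, hs⟩ := Seminorm.bound_of_continuous withSeminorms q hq
  refine ⟨natStep (s.sup Sigma.fst), C, by positivity, fun φ => (hs φ).trans ?_⟩
  refine mul_le_mul_of_nonneg_left ?_ C.2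
  refine Seminorm.finset_sup_apply_le (norm_nonneg _) fun i hi => ?_
  exact norm_toStep_mono (natStep_mono (Finset.le_sup (f := Sigma.fst) hi)) φ

theorem exists_norm_le_norm_toStep (f : Dual d M A) :
    ∃ (h : {h : ℝ // 0 < h}) (C : ℝ), 0 < C ∧ ∀ φ, ‖f φ‖ ≤ C * ‖toStep h φ‖ :=
  exists_le_norm_toStep (q := (normSeminorm ℂ ℂ).comp f.toLinearMap) f.continuous.norm

theorem continuous_of_norm_le (l : GSBeurling d M A →ₗ[ℂ] ℂ) (h : {h : ℝ // 0 < h}) (C : ℝ)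
    (hl : ∀ φ, ‖l φ‖ ≤ C * ‖toStep h φ‖) : Continuous l := by
  refine continuous_of_continuousAt_zero l ?_
  have h1 : Filter.Tendsto (fun φ : GSBeurling d M A => C * ‖toStep h φ‖) (nhds 0) (nhds 0) := by
    have := ((continuous_toStep (d := d) (M := M) (A := A) h).norm.const_mul C).tendsto 0
    simpa using this
  rw [ContinuousAt, map_zero]
  exact squeeze_zero_norm hl h1

/-- `φ ↦ φ(x - ·)` as a linear map. -/
noncomputable def reflectₗ (x : EuclideanSpace ℝ (Fin d)) : GSBeurling d M A →ₗ[ℂ] GSBeurling d M A where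
  toFun φ := reflect φ x
  map_add' _ _ := rfl
  map_smul' _ _ := rfl

theorem norm_toStep_reflect_le {h h' : {h : ℝ // 0 < h}} (hh : (h' : ℝ) = 2 * h)
    (φ : GSBeurling d M A) (x : EuclideanSpace ℝ (Fin d)) :
    ‖toStep h (reflect φ x)‖ ≤ A.expAssoc (h' * ‖x‖) * ‖toStep h' φ‖ :=
  GSStep.norm_le _ fun i => GSStep.gsTerm_reflect_le hh (toStep h' φ) x i

theorem exists_norm_conv_le (f : Dual d M A) : ∃ (h : {h : ℝ // 0 < h}) (C : ℝ), 0 < C ∧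
    ∀ φ x, ‖conv f φ x‖ ≤ C * (A.expAssoc (h * ‖x‖) * ‖toStep h φ‖) := by
  obtain ⟨h, C, hC, hf⟩ := exists_norm_le_norm_toStep f
  refine ⟨⟨2 * h, mul_pos two_pos h.2⟩, C, hC, fun φ x => (hf _).trans ?_⟩
  exact mul_le_mul_of_nonneg_left (norm_toStep_reflect_le rfl φ x) hC.le

/-- **Uniform boundedness**: weighted bounds for all `f * φ` hold uniformly in `φ`. -/
theorem exists_norm_conv_le_of_forall_bddAbove {f : Dual d M A}
    {W : EuclideanSpace ℝ (Fin d) → ℝ} (hW : ∀ x, 0 < W x)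
    (hb : ∀ φ, BddAbove (Set.range fun x => (W x)⁻¹ * ‖conv f φ x‖)) :
    ∃ (h : {h : ℝ // 0 < h}) (C : ℝ), 0 < C ∧
      ∀ φ x, ‖conv f φ x‖ ≤ C * (W x * ‖toStep h φ‖) := by
  obtain ⟨k, C₀, hC₀, hk⟩ := exists_norm_conv_le f
  set p : EuclideanSpace ℝ (Fin d) → Seminorm ℂ (GSBeurling d M A) := fun x =>
    (normSeminorm ℂ ℂ).comp ((((W x)⁻¹ : ℝ) : ℂ) • (f.toLinearMap ∘ₗ reflectₗ x)) with hp
  have hpx : ∀ x φ, p x φ = (W x)⁻¹ * ‖conv f φ x‖ := by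
    intro x φ
    change ‖(((W x)⁻¹ : ℝ) : ℂ) * conv f φ x‖ = _
    rw [norm_mul, Complex.norm_real, Real.norm_of_nonneg (inv_pos.2 (hW x)).le]
  have hpc : ∀ x, Continuous (p x) := by
    intro x
    have : Continuous (f.toLinearMap ∘ₗ reflectₗ x : GSBeurling d M A →ₗ[ℂ] ℂ) :=
      continuous_of_norm_le _ k (C₀ * A.expAssoc (k * ‖x‖)) fun φ => by
        rw [mul_assoc]
        exact hk φ x
    exact (this.const_smul (((W x)⁻¹ : ℝ) : ℂ)).norm
  have hbdd : BddAbove (Set.range p) := by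
    rw [Seminorm.bddAbove_range_iff]
    intro φ
    simp only [hpx]
    exact hb φ
  -- The Baire property enters here: a pointwise bounded supremum of continuous seminorms is
  -- continuous.
  have hcont := Seminorm.continuous_iSup p hpc hbdd
  have hcont' : Continuous (⨆ x, p x : Seminorm ℂ (GSBeurling d M A)) := by
    rw [Seminorm.coe_iSup_eq hbdd]
    exact hcont
  obtain ⟨h, C, hC, hq⟩ := exists_le_norm_toStep hcont'
  refine ⟨h, C, hC, fun φ x => ?_⟩
  have h1 : p x φ ≤ (⨆ x, p x : Seminorm ℂ (GSBeurling d M A)) φ := le_ciSup hbdd x φ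
  have h2 := h1.trans (hq φ)
  rw [hpx, inv_mul_le_iff₀ (hW x)] at h2
  linarith

/-- Localization as a linear map into the space with exponential decay. -/
noncomputable def localizeₗ {θ : EuclideanSpace ℝ (Fin d) → ℂ} (hθ : IsLocalizer M θ)
    (A : DecayWeight) (y : EuclideanSpace ℝ (Fin d)) :
    GSBeurling d M A →ₗ[ℂ] GSBeurling d M factorialWeight where
  toFun ψ := ⟨localize θ y ψ.1, (Submodule.mem_iInf _).2 fun h =>
    hθ.localize_mem (k := ⟨2 * h, mul_pos two_pos h.2⟩) rfl ((Submodule.mem_iInf _).1 ψ.2 _) y⟩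
  map_add' ψ φ := Subtype.ext (funext fun z => add_mul (ψ.1 (y - z)) (φ.1 (y - z)) (θ z))
  map_smul' c ψ := Subtype.ext (funext fun z => mul_assoc c (ψ.1 (y - z)) (θ z))

theorem belongsToDual_iff (A : DecayWeight) (f : Dual d M factorialWeight) :
    BelongsToDual A f ↔ ∃ t : ℝ, 0 < t ∧ ∀ φ : GSBeurling d M factorialWeight,
      BddAbove (Set.range fun x : EuclideanSpace ℝ (Fin d) =>
        Real.exp (-associatedFunction A (t * ‖x‖)) * ‖conv f φ x‖) := by
  constructor
  · rintro ⟨g, hg⟩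
    obtain ⟨h, C, hC, hb⟩ := exists_norm_conv_le g
    refine ⟨h, h.2, fun φ => ⟨C * ‖toStep h (ofFactorial M A φ)‖, ?_⟩⟩
    rintro _ ⟨x, rfl⟩
    have h1 := hb (ofFactorial M A φ) x
    have h2 : conv g (ofFactorial M A φ) x = conv f φ x := hg (reflect φ x)
    rw [h2] at h1
    change Real.exp (-associatedFunction A (h * ‖x‖)) * ‖conv f φ x‖ ≤ _
    rw [Real.exp_neg, inv_mul_le_iff₀ (Real.exp_pos _)]
    change _ ≤ A.expAssoc (h * ‖x‖) * _
    linarith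
  · rintro ⟨t, ht, hb⟩
    obtain ⟨θ, hθs, hθb, hsum⟩ := M.exists_partition_of_unity d
    have hθ : IsLocalizer M θ := ⟨hθs, hθb⟩
    obtain ⟨h, C, hC, hf⟩ := exists_norm_conv_le_of_forall_bddAbove (f := f)
      (W := fun x => A.expAssoc (t * ‖x‖)) (fun x => A.expAssoc_pos _) (by
        simpa only [Real.exp_neg] using! hb)
    obtain ⟨H, hH, hHdiv⟩ := A.exists_expAssoc_div_le
    obtain ⟨C₁, hC₁, hdiv⟩ := hHdiv (2 * d) t ht
    have hh : (0 : ℝ) < h := h.2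
    -- Since localization halves the scale, `k / 2` must reach both the step `h` of the uniform
    -- bound and the scale `H t` that beats the growth `exp A(t|x|)` summably.
    set k : {h : ℝ // 0 < h} := ⟨2 * max (h : ℝ) (H * t), mul_pos two_pos (lt_max_of_lt_left hh)⟩ with hk
    have hkh : (h : ℝ) ≤ (k : ℝ) / 2 := by
      rw [hk, mul_div_cancel_left₀ _ two_ne_zero]
      exact le_max_left _ _
    have hkt : H * t ≤ (k : ℝ) / 2 := by
      rw [hk, mul_div_cancel_left₀ _ two_ne_zero]
      exact le_max_right _ _
    obtain ⟨C₂, hC₂, hloc⟩ := hθ.exists_gsTerm_localize_le A k.2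
    -- The `n`-th term of the extension: `f * localize θ n ψ` evaluated at the lattice point `n`.
    set l : (Fin d → ℤ) → GSBeurling d M A →ₗ[ℂ] ℂ := fun n =>
      f.toLinearMap ∘ₗ reflectₗ (latticePoint n) ∘ₗ localizeₗ hθ A (latticePoint n) with hl
    have hlb : ∀ ψ n, ‖l n ψ‖ ≤
        C * C₂ * C₁ * ‖toStep k ψ‖ * (1 / (1 + ‖latticePoint n‖) ^ (2 * d)) := by
      intro ψ n
      have h1 : ‖l n ψ‖ ≤ _ := hf (localizeₗ hθ A (latticePoint n) ψ) (latticePoint n)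
      have h2 : ‖toStep h (localizeₗ hθ A (latticePoint n) ψ)‖ ≤
          C₂ * ‖toStep k ψ‖ * (A.expAssoc (H * t * ‖latticePoint n‖))⁻¹ := by
        refine GSStep.norm_le _ fun i => ?_
        refine (gsTerm_le_gsTerm h.2 hkh _ i).trans ((hloc ψ.1 _ (toStep k ψ).2.1
          (toStep k ψ).gsTerm_le_norm (latticePoint n) i).trans ?_)
        have h3 := A.expAssoc_mono (ρ := H * t * ‖latticePoint n‖)
          (ρ' := (k : ℝ) / 2 * ‖latticePoint n‖) (by positivity) (by gcongr)
        have h4 := A.expAssoc_pos (H * t * ‖latticePoint n‖)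
        gcongr
      have h5 := hdiv ‖latticePoint n‖ (norm_nonneg _)
      have h6 := A.expAssoc_pos (t * ‖latticePoint n‖)
      calc ‖l n ψ‖ ≤ C * (A.expAssoc (t * ‖latticePoint n‖) *
            (C₂ * ‖toStep k ψ‖ * (A.expAssoc (H * t * ‖latticePoint n‖))⁻¹)) :=
            h1.trans (by gcongr)
        _ = C * C₂ * ‖toStep k ψ‖ * (A.expAssoc (t * ‖latticePoint n‖) /
            A.expAssoc (H * t * ‖latticePoint n‖)) := by ring
        _ ≤ C * C₂ * ‖toStep k ψ‖ * (C₁ / (1 + ‖latticePoint n‖) ^ (2 * d)) := by gcongr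
        _ = _ := by ring
    have hS := summable_inv_one_add_norm_latticePoint_pow d
    have hls : ∀ ψ, Summable fun n => l n ψ := fun ψ =>
      Summable.of_norm_bounded (hS.mul_left _) (hlb ψ)
    refine ⟨⟨tsumLinearMap l hls, continuous_of_norm_le _ k
      ((∑' n : Fin d → ℤ, 1 / (1 + ‖latticePoint n‖) ^ (2 * d)) * (C * C₂ * C₁)) fun ψ => ?_⟩,
      fun φ => ?_⟩
    · rw [mul_assoc]
      exact norm_tsumLinearMap_le hls hS (hlb ψ)
    · obtain ⟨H', hH', hrec⟩ := hθ.hasSum_localize hsum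
      have h1 : HasSum (fun n : Fin d → ℤ =>
          reflect (localizeₗ hθ A (latticePoint n) (ofFactorial M A φ)) (latticePoint n)) φ := by
        refine tendsto_nhds_iff.2 fun h => ?_
        have h2 := hrec h (toStep h φ) (fun n => toStep h
          (reflect (localizeₗ hθ A (latticePoint n) (ofFactorial M A φ)) (latticePoint n)))
          ((Submodule.mem_iInf _).1 φ.2 ⟨4 * H' * h, by have := h.2; positivity⟩).2
          fun n w => rfl
        refine Filter.Tendsto.congr (fun s => ?_) h2
        rw [map_sum]
      exact (f.hasSum h1).tsum_eq

end GSBeurling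

/-! ### The Roumieu case -/

namespace GSRoumieu

variable {d : ℕ} {M : RegularityWeight} {A : DecayWeight}

theorem continuous_ofStep (h : {h : ℝ // 0 < h}) :
    Continuous (ofStep (d := d) (M := M) (A := A) h) :=
  continuous_sInf_rng.2 fun _ hτ => hτ.2.2.2 h

/-- A linear functional on the inductive limit is continuous if its restrictions to all steps
are. -/
theorem continuous_of_forall_step (l : GSRoumieu d M A →ₗ[ℂ] ℂ)
    (hl : ∀ h, Continuous fun φ : GSStep d M A h => l (ofStep h φ)) : Continuous l := by
  rw [continuous_iff_le_induced]
  -- The topology induced by `l` is one of the competitors in the infimum defining the inductive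
  -- limit topology.
  refine sInf_le ⟨topologicalAddGroup_induced l, continuousSMul_induced l, ?_, fun h => ?_⟩
  · let _ : Module ℝ (GSRoumieu d M A) := Module.complexToReal _
    exact LocallyConvexSpace.induced (l.restrictScalars ℝ)
  · exact continuous_induced_rng.2 (hl h)

/-- The restriction of a functional to a step. -/
noncomputable def restrictStep (f : Dual d M A) (h : {h : ℝ // 0 < h}) : GSStep d M A h →L[ℂ] ℂ :=
  ⟨f.toLinearMap ∘ₗ ofStep h, f.continuous.comp (continuous_ofStep h)⟩

/-- `φ ↦ φ(x - ·)` as a linear map. -/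
noncomputable def reflectₗ (x : EuclideanSpace ℝ (Fin d)) : GSRoumieu d M A →ₗ[ℂ] GSRoumieu d M A where
  toFun φ := reflect φ x
  map_add' _ _ := rfl
  map_smul' _ _ := rfl

theorem norm_conv_ofStep_le (f : Dual d M A) {h h' : {h : ℝ // 0 < h}} (hh : (h' : ℝ) = 2 * h)
    (φ : GSStep d M A h') (x : EuclideanSpace ℝ (Fin d)) :
    ‖conv f (ofStep h' φ) x‖ ≤ ‖restrictStep f h‖ * (A.expAssoc (h' * ‖x‖) * ‖φ‖) := by
  have h1 := (restrictStep f h).le_opNorm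
    (GSStep.mk (fun y => φ.1 (x - y)) (reflect_mem_gsStepSubmodule M A hh φ.2 x))
  refine h1.trans (mul_le_mul_of_nonneg_left ?_ (norm_nonneg _))
  exact GSStep.norm_le _ fun i => GSStep.gsTerm_reflect_le hh φ x i

/-- An element of step `k` belongs to every lower step, so one function satisfies growth bounds at
all scales `h' ≤ k`, with constants not depending on it. -/
theorem norm_conv_ofStep_le_of_le (f : Dual d M A) {h h' k : {h : ℝ // 0 < h}}
    (hh : (h' : ℝ) = 2 * h) (hle : h' ≤ k) (φ : GSStep d M A k) (x : EuclideanSpace ℝ (Fin d)) :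
    ‖conv f (ofStep k φ) x‖ ≤ ‖restrictStep f h‖ * (A.expAssoc (h' * ‖x‖) * ‖φ‖) := by
  have h1 : ‖GSStep.inclusionCLM hle φ‖ ≤ ‖φ‖ :=
    GSStep.norm_le _ fun i => (gsTerm_le_gsTerm h'.2 hle φ.1 i).trans (φ.gsTerm_le_norm i)
  exact (norm_conv_ofStep_le f hh (GSStep.inclusionCLM hle φ) x).trans
    (mul_le_mul_of_nonneg_left (mul_le_mul_of_nonneg_left h1 (A.expAssoc_pos _).le)
      (norm_nonneg _))

/-- The step `1 / (n + 1)`. -/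
noncomputable def invStep (n : ℕ) : {h : ℝ // 0 < h} := ⟨1 / (n + 1), by positivity⟩

/-- The step `1 / (2 (n + 1))`. -/
noncomputable def halfInvStep (n : ℕ) : {h : ℝ // 0 < h} := ⟨1 / (n + 1) / 2, by positivity⟩

/-- **Uniform boundedness**: weighted bounds for all `f * φ` hold uniformly in `φ` on every step. -/
theorem exists_norm_conv_le_of_forall_bddAbove {f : Dual d M A}
    {W : EuclideanSpace ℝ (Fin d) → ℝ} (hW : ∀ x, 0 < W x)
    (hb : ∀ φ, BddAbove (Set.range fun x => (W x)⁻¹ * ‖conv f φ x‖)) (h : {h : ℝ // 0 < h}) :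
    ∃ C : ℝ, 0 < C ∧ ∀ (φ : GSStep d M A h) x,
      ‖conv f (ofStep h φ) x‖ ≤ C * (W x * ‖φ‖) := by
  set h₂ : {h : ℝ // 0 < h} := ⟨h / 2, half_pos h.2⟩ with hh₂
  have hh : (h : ℝ) = 2 * h₂ := by
    rw [hh₂]
    ring
  set T : EuclideanSpace ℝ (Fin d) → GSStep d M A h →L[ℂ] ℂ := fun x =>
    (((W x)⁻¹ : ℝ) : ℂ) • LinearMap.mkContinuous (f.toLinearMap ∘ₗ reflectₗ x ∘ₗ ofStep h)
      (‖restrictStep f h₂‖ * A.expAssoc (h * ‖x‖)) fun φ => by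
        rw [mul_assoc]
        exact norm_conv_ofStep_le f hh φ x
  have hT : ∀ x φ, ‖T x φ‖ = (W x)⁻¹ * ‖conv f (ofStep h φ) x‖ := by
    intro x φ
    change ‖(((W x)⁻¹ : ℝ) : ℂ) * conv f (ofStep h φ) x‖ = _
    rw [norm_mul, Complex.norm_real, Real.norm_of_nonneg (inv_pos.2 (hW x)).le]
  obtain ⟨C, hC⟩ := banach_steinhaus (g := T) fun φ => by
    obtain ⟨C, hC⟩ := hb (ofStep h φ)
    exact ⟨C, fun x => by
      rw [hT]
      exact hC ⟨x, rfl⟩⟩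
  refine ⟨max C 1, by positivity, fun φ x => ?_⟩
  have h1 := ((T x).le_opNorm φ).trans
    (mul_le_mul_of_nonneg_right ((hC x).trans (le_max_left C 1)) (norm_nonneg φ))
  rw [hT, inv_mul_le_iff₀ (hW x)] at h1
  linarith

/-- Localization as a linear map into the space with exponential decay. -/
noncomputable def localizeₗ {θ : EuclideanSpace ℝ (Fin d) → ℂ} (hθ : IsLocalizer M θ)
    (A : DecayWeight) (y : EuclideanSpace ℝ (Fin d)) :
    GSRoumieu d M A →ₗ[ℂ] GSRoumieu d M factorialWeight where
  toFun ψ := ⟨localize θ y ψ.1, by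
    obtain ⟨h, hψ⟩ := mem_iSup_gsStepSubmodule.1 ψ.2
    exact mem_iSup_gsStepSubmodule.2 ⟨⟨h / 2, half_pos h.2⟩, hθ.localize_mem (by ring) hψ y⟩⟩
  map_add' ψ φ := Subtype.ext (funext fun z => add_mul (ψ.1 (y - z)) (φ.1 (y - z)) (θ z))
  map_smul' c ψ := Subtype.ext (funext fun z => mul_assoc c (ψ.1 (y - z)) (θ z))

theorem exists_ofStep_eq (φ : GSRoumieu d M A) : ∃ h ψ, ofStep h ψ = φ := by
  obtain ⟨h, hφ⟩ := mem_iSup_gsStepSubmodule.1 φ.2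
  exact ⟨h, GSStep.mk φ.1 hφ, rfl⟩

theorem exists_twistedWeight_of_belongsToDual {f : Dual d M factorialWeight}
    (hf : BelongsToDual A f) :
    ∃ t : ℕ → ℝ, IsIncreasingToInfinity t ∧ ∀ φ : GSRoumieu d M factorialWeight,
      BddAbove (Set.range fun x : EuclideanSpace ℝ (Fin d) =>
        Real.exp (-associatedFunction (twistedWeight A t) ‖x‖) * ‖conv f φ x‖) := by
  obtain ⟨g, hg⟩ := hf
  -- The weight is chosen from the norms of `g` on the steps alone, before `φ`. The index `n - 1`
  -- matches `invStep (n - 1) = 1 / n`.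
  obtain ⟨t, ht, htK⟩ := exists_twistedWeight_of_forall_le A fun n =>
    ‖restrictStep g (halfInvStep (n - 1))‖
  refine ⟨t, ht, fun φ => ?_⟩
  obtain ⟨h, ψ, hψ⟩ := exists_ofStep_eq (ofFactorial M A φ)
  have hh : (0 : ℝ) < h := h.2
  obtain ⟨n₀, hn₀⟩ := exists_nat_gt (h : ℝ)⁻¹
  obtain ⟨C, hC, hX⟩ := htK (n₀ + 1) (by omega)
  -- Dividing by `‖ψ‖ + 1` normalizes the bound without excluding `ψ = 0`.
  have hψ0 : 0 < ‖ψ‖ + 1 := by linarith [norm_nonneg ψ]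
  have hle : ∀ m, n₀ ≤ m → invStep m ≤ h := by
    intro m hm
    have hm' : (n₀ : ℝ) ≤ m := by exact_mod_cast hm
    refine Subtype.coe_le_coe.1 ?_
    change 1 / ((m : ℝ) + 1) ≤ h
    rw [div_le_iff₀ (by positivity), ← inv_le_iff_one_le_mul₀' hh]
    linarith
  have key : ∀ x, ‖conv f φ x‖ / (‖ψ‖ + 1) ≤
      C * Real.exp (associatedFunction (twistedWeight A t) ‖x‖) := by
    intro x
    refine hX ‖x‖ _ (norm_nonneg x) fun n hn => ?_
    obtain ⟨m, rfl⟩ : ∃ m, n = m + 1 := ⟨n - 1, by omega⟩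
    have h2 := norm_conv_ofStep_le_of_le g (h := halfInvStep m) (h' := invStep m)
      (show 1 / ((m : ℝ) + 1) = 2 * (1 / ((m : ℝ) + 1) / 2) by ring) (hle m (by omega)) ψ x
    have hconv : conv g (ofFactorial M A φ) x = conv f φ x := hg (reflect φ x)
    have h5 : (invStep m : ℝ) * ‖x‖ = ‖x‖ / ((m + 1 : ℕ) : ℝ) := by
      change 1 / ((m : ℝ) + 1) * ‖x‖ = _
      push_cast
      ring
    rw [hψ, hconv, h5] at h2
    rw [div_le_iff₀ hψ0, Nat.add_sub_cancel, mul_assoc]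
    refine h2.trans (mul_le_mul_of_nonneg_left (mul_le_mul_of_nonneg_left ?_
      (A.expAssoc_pos _).le) (norm_nonneg _))
    linarith
  refine ⟨C * (‖ψ‖ + 1), ?_⟩
  rintro _ ⟨x, rfl⟩
  have h1 := key x
  rw [div_le_iff₀ hψ0] at h1
  simp only
  rw [Real.exp_neg, inv_mul_le_iff₀ (Real.exp_pos _)]
  linarith

theorem belongsToDual_of_twistedWeight {f : Dual d M factorialWeight} {t : ℕ → ℝ}
    (ht : IsIncreasingToInfinity t)
    (hb : ∀ φ : GSRoumieu d M factorialWeight,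
      BddAbove (Set.range fun x : EuclideanSpace ℝ (Fin d) =>
        Real.exp (-associatedFunction (twistedWeight A t) ‖x‖) * ‖conv f φ x‖)) :
    BelongsToDual A f := by
  obtain ⟨θ, hθs, hθb, hsum⟩ := M.exists_partition_of_unity d
  have hθ : IsLocalizer M θ := ⟨hθs, hθb⟩
  obtain ⟨H, hH, hHdiv⟩ := A.exists_expAssoc_div_le
  set l : (Fin d → ℤ) → GSRoumieu d M A →ₗ[ℂ] ℂ := fun n =>
    f.toLinearMap ∘ₗ reflectₗ (latticePoint n) ∘ₗ localizeₗ hθ A (latticePoint n) with hl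
  have hlb : ∀ h : {h : ℝ // 0 < h}, ∃ C : ℝ, 0 < C ∧ ∀ (ψ : GSStep d M A h) n,
      ‖l n (ofStep h ψ)‖ ≤ C * ‖ψ‖ * (1 / (1 + ‖latticePoint n‖) ^ (2 * d)) := by
    intro k
    have hk : (0 : ℝ) < k := k.2
    obtain ⟨C, hC, hf⟩ := exists_norm_conv_le_of_forall_bddAbove (f := f)
      (W := fun x => Real.exp (associatedFunction (twistedWeight A t) ‖x‖))
      (fun x => Real.exp_pos _) (by simpa only [Real.exp_neg] using! hb) ⟨k / 2, half_pos hk⟩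
    -- A twisted weight grows more slowly than `exp A(κ|x|)` for every `κ`, so `κ` may be adapted to
    -- the step `k`: then `H κ = k / 2` is exactly the decay left after localization.
    set κ : ℝ := k / 2 / H with hκ
    have hκ0 : 0 < κ := by positivity
    have hκH : H * κ = k / 2 := by
      rw [hκ]
      field_simp
    obtain ⟨C₁, hC₁, hdiv⟩ := hHdiv (2 * d) κ hκ0
    obtain ⟨C₂, hC₂, hloc⟩ := hθ.exists_gsTerm_localize_le A hk
    obtain ⟨C₃, hC₃, htw⟩ := exists_exp_associatedFunction_twistedWeight_le A ht hκ0
    refine ⟨C * C₂ * C₃ * C₁, by positivity, fun ψ n => ?_⟩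
    set y := latticePoint n
    set φ : GSStep d M factorialWeight ⟨k / 2, half_pos hk⟩ :=
      GSStep.mk (localize θ y ψ.1) (hθ.localize_mem (by ring) ψ.2 y)
    have h1 : ‖l n (ofStep k ψ)‖ ≤ _ := hf φ y
    have h2 : ‖φ‖ ≤ C₂ * ‖ψ‖ * (A.expAssoc (H * κ * ‖y‖))⁻¹ := by
      rw [hκH]
      exact GSStep.norm_le _ fun i => hloc ψ.1 _ ψ.2.1 ψ.gsTerm_le_norm y i
    have h3 := htw ‖y‖ (norm_nonneg _)
    have h5 := hdiv ‖y‖ (norm_nonneg _)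
    have h6 := A.expAssoc_pos (κ * ‖y‖)
    calc ‖l n (ofStep k ψ)‖ ≤ C * (C₃ * A.expAssoc (κ * ‖y‖) *
          (C₂ * ‖ψ‖ * (A.expAssoc (H * κ * ‖y‖))⁻¹)) := h1.trans (by gcongr)
      _ = C * C₂ * C₃ * ‖ψ‖ * (A.expAssoc (κ * ‖y‖) / A.expAssoc (H * κ * ‖y‖)) := by ring
      _ ≤ C * C₂ * C₃ * ‖ψ‖ * (C₁ / (1 + ‖y‖) ^ (2 * d)) := by gcongr
      _ = _ := by ring
  have hS := summable_inv_one_add_norm_latticePoint_pow d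
  have hls : ∀ ψ, Summable fun n => l n ψ := fun φ => by
    obtain ⟨h, ψ, rfl⟩ := exists_ofStep_eq φ
    obtain ⟨C, -, hC⟩ := hlb h
    exact Summable.of_norm_bounded (hS.mul_left _) (hC ψ)
  refine ⟨⟨tsumLinearMap l hls, continuous_of_forall_step _ fun h => ?_⟩, fun φ => ?_⟩
  · obtain ⟨C, -, hC⟩ := hlb h
    refine AddMonoidHomClass.continuous_of_bound (tsumLinearMap l hls ∘ₗ ofStep h)
      ((∑' n : Fin d → ℤ, 1 / (1 + ‖latticePoint n‖) ^ (2 * d)) * C) fun ψ => ?_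
    rw [mul_assoc]
    exact norm_tsumLinearMap_le hls hS (hC ψ)
  · obtain ⟨H', hH', hrec⟩ := hθ.hasSum_localize hsum
    obtain ⟨k, ψ, rfl⟩ := exists_ofStep_eq φ
    have hk : (0 : ℝ) < k := k.2
    -- The decomposition converges only in a larger step, with index smaller by `4 H'`; this
    -- suffices, as `f` is continuous on every step.
    set h : {h : ℝ // 0 < h} := ⟨k / (4 * H'), by positivity⟩ with hh
    have hkh : 4 * H' * (h : ℝ) = k := by
      rw [hh]
      field_simp
    have hhk : h ≤ k := Subtype.coe_le_coe.1 (div_le_self hk.le (by linarith))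
    have hmem : ∀ n : Fin d → ℤ, (fun w => localize θ (latticePoint n) ψ.1 (latticePoint n - w)) ∈
        gsStepSubmodule d M factorialWeight h := fun n =>
      gsStepSubmodule_anti M factorialWeight
        (h' := ⟨k / 4, by positivity⟩)
        (Subtype.coe_le_coe.1 (div_le_div_of_nonneg_left hk.le (by norm_num) (by linarith)))
        (reflect_mem_gsStepSubmodule M factorialWeight (h' := ⟨k / 2, by positivity⟩)
          (by simp only; ring) (hθ.localize_mem (by simp only; ring) ψ.2 _) _)
    have h2 := hrec h (GSStep.inclusionCLM hhk ψ) (fun n => GSStep.mk _ (hmem n)) (by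
      rw [hkh]
      exact ψ.2.2) fun n w => rfl
    exact ((restrictStep f h).hasSum h2).tsum_eq

theorem belongsToDual_iff (A : DecayWeight) (f : Dual d M factorialWeight) :
    BelongsToDual A f ↔
      ∃ t : ℕ → ℝ, IsIncreasingToInfinity t ∧ ∀ φ : GSRoumieu d M factorialWeight,
        BddAbove (Set.range fun x : EuclideanSpace ℝ (Fin d) =>
          Real.exp (-associatedFunction (twistedWeight A t) ‖x‖) * ‖conv f φ x‖) :=
  ⟨exists_twistedWeight_of_belongsToDual, fun ⟨_, ht, hb⟩ => belongsToDual_of_twistedWeight ht hb⟩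

end GSRoumieu

theorem mainTheorem6 (d : ℕ) (M : RegularityWeight) (A : DecayWeight) :
    (∀ f : GSBeurling.Dual d M factorialWeight,
      GSBeurling.BelongsToDual A f ↔
        ∃ t : ℝ, 0 < t ∧ ∀ φ : GSBeurling d M factorialWeight,
          BddAbove (Set.range fun x : EuclideanSpace ℝ (Fin d) =>
            Real.exp (-associatedFunction A (t * ‖x‖)) * ‖GSBeurling.conv f φ x‖)) ∧
    (∀ f : GSRoumieu.Dual d M factorialWeight,
      GSRoumieu.BelongsToDual A f ↔
        ∃ t : ℕ → ℝ, IsIncreasingToInfinity t ∧ ∀ φ : GSRoumieu d M factorialWeight,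
          BddAbove (Set.range fun x : EuclideanSpace ℝ (Fin d) =>
            Real.exp (-associatedFunction (twistedWeight A t) ‖x‖) * ‖GSRoumieu.conv f φ x‖)) :=
  ⟨GSBeurling.belongsToDual_iff A, GSRoumieu.belongsToDual_iff A⟩
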